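/- Let $D\ge 1$, $Q=\{1,\dots,D\}$, $m,p\ge 0$. A linear switched system (LSS) of dimension $n\ge 0$ is a family $\Sigma=(A_q,B_q,C_q)_{q\in Q}$ with $A_q\in\mathbb R^{n\times n}$, $B_q\in\mathbb R^{n\times m}$, $C_q\in\mathbb R^{p\times n}$. In continuous time ($T=[0,\infty)$) the inputs are $u\in L_2(T,\mathbb R^m)$, the switching signals $q:T\to Q$ and outputs $y:T\to\mathbb R^p$ are piecewise continuous (finitely many discontinuities on each compact interval, with finite one-sided limits there), the states $x:T\to\mathbb R^n$ are locally absolutely continuous, and the solution with zero initial state satisfies $$\dot x(t)=A_{q(t)}x(t)+B_{q(t)}u(t)\ \text{ for a.e. } t,\qquad x(0)=0,\qquad y(t)=C_{q(t)}x(t)\ \text{ for all } t.$$ In discrete time the inputs are $u\in l_2(\mathbb N,\mathbb R^m)$, the switching signals are all sequences in $Q$, and $$x(t+1)=A_{q(t)}x(t)+B_{q(t)}u(t),\qquad x(0)=0,\qquad y(t)=C_{q(t)}x(t)\qquad (t\in\mathbb N).$$ The input-output map of $\Sigma$ is $Y^\Sigma:(u,q)\mapsto y$. Two LSSs with the same $Q,m,p$,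 of possibly different dimensions, are equivalent if $Y^{\Sigma_1}=Y^{\Sigma_2}$; an LSS is minimal if no LSS equivalent to it has smaller dimension. For $\gamma>0$ let $\mathbf G_\gamma(\Sigma)$ be the set of symmetric positive definite $P\in\mathbb R^{n\times n}$ such that, for every $q\in Q$, the following matrix is negative definite: $$\begin{bmatrix}A_q^TP+PA_q+C_q^TC_q & PB_q\\ B_q^TP & -\gamma^2 I\end{bmatrix}\ \text{(continuous time)},$$ $$\begin{bmatrix}A_q^TPA_q+C_q^TC_q-P & A_q^TPB_q\\ B_q^TPA_q & B_q^TPB_q-\gamma^2 I\end{bmatrix}\ \text{(discrete time)}.$$ Put $\gamma(\Sigma)=\inf\{\gamma>0\mid \mathbf G_\gamma(\Sigma)\neq\emptyset\}\in[0,+\infty]$, with $\inf\emptyset=+\infty$. Then, both in continuous and in discrete time: 1. If $\Sigma$ is an LSS and $\Sigma_m$ is a minimal LSS equivalent to $\Sigma$, then $\gamma(\Sigma_m)\le\gamma(\Sigma)$. 2. If $\Sigma_1,\Sigma_2$ are equivalent minimal LSSs, then $\gamma(\Sigma_1)=\gamma(\Sigma_2)$. 3. Consequently, for minimal $\Sigma$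 the number $\gamma(\Sigma)$ depends only on the input-output map: there is a map $\Gamma$ from input-output maps to $[-\infty,+\infty]$ such that $\gamma(\Sigma)=\Gamma(Y^\Sigma)$ for every minimal LSS $\Sigma$. -/

import Mathlib

open MeasureTheory Filter Topology
open scoped NNReal Matrix

/-- The two kinds of time axis: `T = [0, ∞)` or `ℕ`. -/
inductive TimeAxis where
  | continuous
  | discrete

/-- The set of time instants. -/
abbrev TimeAxis.Time : TimeAxis → Type
  | .continuous => ℝ≥0
  | .discrete => ℕ

/-- `PC(T, E)`: finitely many points of discontinuity on each compact subinterval of `T = [0, ∞)`,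
and one-sided limits at each point of discontinuity (at `0` the condition on the left-hand limit is
void, since `𝓝[<] (0 : ℝ≥0) = ⊥`). -/
def IsPiecewiseContinuous {E : Type} [TopologicalSpace E] (f : ℝ≥0 → E) : Prop :=
  (∀ a b : ℝ≥0, {t | t ∈ Set.Icc a b ∧ ¬ ContinuousAt f t}.Finite) ∧
  ∀ t, ¬ ContinuousAt f t →
    (∃ l, Tendsto f (𝓝[<] t) (𝓝 l)) ∧ ∃ r, Tendsto f (𝓝[>] t) (𝓝 r)

/-- `AC(T, ℝⁿ)`: absolutely continuous on each compact subinterval of `T = [0, ∞)`. -/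
def IsLocallyAbsolutelyContinuous {n : ℕ} (x : ℝ≥0 → Fin n → ℝ) : Prop :=
  ∀ b : ℝ≥0, AbsolutelyContinuousOnInterval (fun s : ℝ => x s.toNNReal) 0 b

/-- Control inputs: `L₂(T, ℝᵐ)` in continuous time and `l₂(ℝᵐ)` in discrete time, for the Euclidean
norm of `ℝᵐ`. -/
def IsInput {m : ℕ} : (τ : TimeAxis) → (τ.Time → Fin m → ℝ) → Prop
  | .continuous, u =>
      MemLp (fun t : ℝ => WithLp.toLp 2 (u t.toNNReal)) 2 (volume.restrict (Set.Ici 0))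
  | .discrete, u => Memℓp (fun t : ℕ => WithLp.toLp 2 (u t)) 2

/-- Switching signals: `PC(T, Q)` (`Q` is discrete) in continuous time, all sequences in discrete
time. -/
def IsSwitchingSignal {D : ℕ} : (τ : TimeAxis) → (τ.Time → Fin D) → Prop
  | .continuous, q => IsPiecewiseContinuous q
  | .discrete, _ => True

/-- The space of control inputs. -/
abbrev InputSpace (τ : TimeAxis) (m : ℕ) : Type := {u : τ.Time → Fin m → ℝ // IsInput τ u}

/-- The space of switching signals. -/
abbrev SwitchingSpace (τ : TimeAxis) (D : ℕ) : Type :=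
  {q : τ.Time → Fin D // IsSwitchingSignal τ q}

/-- A linear switched system of dimension `n` with `D` discrete modes, `m` inputs and `p` outputs. -/
structure LSS (D m p n : ℕ) where
  A : Fin D → Matrix (Fin n) (Fin n) ℝ
  B : Fin D → Matrix (Fin n) (Fin m) ℝ
  C : Fin D → Matrix (Fin p) (Fin n) ℝ

namespace LSS

variable {D m p n : ℕ}

/-- `(x, y)` is a solution of `S` with initial state `x₀` relative to `(u, q)`. -/
def IsSolution (S : LSS D m p n) (x₀ : Fin n → ℝ) : (τ : TimeAxis) →
    (u : τ.Time → Fin m → ℝ) → (q : τ.Time → Fin D) →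
    (x : τ.Time → Fin n → ℝ) → (y : τ.Time → Fin p → ℝ) → Prop
  | .continuous, u, q, x, y =>
      IsLocallyAbsolutelyContinuous x ∧ IsPiecewiseContinuous y ∧ x 0 = x₀ ∧
      (∀ᵐ t ∂(volume.restrict (Set.Ici (0 : ℝ))), HasDerivAt (fun s : ℝ => x s.toNNReal)
        (S.A (q t.toNNReal) *ᵥ x t.toNNReal + S.B (q t.toNNReal) *ᵥ u t.toNNReal) t) ∧
      ∀ t, y t = S.C (q t) *ᵥ x t
  | .discrete, u, q, x, y =>
      x 0 = x₀ ∧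
      (∀ t : ℕ, x (t + 1) = S.A (q t) *ᵥ x t + S.B (q t) *ᵥ u t) ∧
      ∀ t, y t = S.C (q t) *ᵥ x t

end LSS

/-- Input-output maps, as graphs: `(u, q)` is sent to the set of the outputs it produces. For a
linear switched system this set has exactly one element, because the solution relative to `(u, q)`
exists and is unique. -/
abbrev IOMap (τ : TimeAxis) (D m p : ℕ) : Type :=
  InputSpace τ m → SwitchingSpace τ D → Set (τ.Time → Fin p → ℝ)

namespace LSS

variable {D m p n : ℕ}

/-- The input-output map induced by the initial state `x₀`. -/
def inputOutputMapFrom (τ : TimeAxis) (S : LSS D m p n) (x₀ : Fin n → ℝ) : IOMap τ D m p :=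
  fun u q => {y | ∃ x, S.IsSolution x₀ τ u.1 q.1 x y}

/-- The input-output map of `S`, that is, the one induced by the zero initial state. -/
def inputOutputMap (τ : TimeAxis) (S : LSS D m p n) : IOMap τ D m p :=
  S.inputOutputMapFrom τ 0

/-- Two systems, possibly of different dimensions, are equivalent. -/
def Equivalent (τ : TimeAxis) {n₁ n₂ : ℕ} (S₁ : LSS D m p n₁) (S₂ : LSS D m p n₂) : Prop :=
  S₁.inputOutputMap τ = S₂.inputOutputMap τ

/-- `S` is a realization of `f`. -/
def IsRealization (τ : TimeAxis) (S : LSS D m p n) (f : IOMap τ D m p) : Prop :=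
  S.inputOutputMap τ = f

/-- `S` is a minimal realization of `f`. -/
def IsMinimalRealization (τ : TimeAxis) (S : LSS D m p n) (f : IOMap τ D m p) : Prop :=
  S.IsRealization τ f ∧ ∀ (k : ℕ) (S' : LSS D m p k), S'.IsRealization τ f → n ≤ k

/-- `S` is a minimal realization of its own input-output map. -/
def IsMinimal (τ : TimeAxis) (S : LSS D m p n) : Prop :=
  S.IsMinimalRealization τ (S.inputOutputMap τ)

/-- The block matrix `G_γ(q, S, P)`. -/
def gainMatrix (S : LSS D m p n) (γ : ℝ) (q : Fin D) (P : Matrix (Fin n) (Fin n) ℝ) :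
    TimeAxis → Matrix (Fin n ⊕ Fin m) (Fin n ⊕ Fin m) ℝ
  | .continuous =>
      Matrix.fromBlocks
        ((S.A q)ᵀ * P + P * S.A q + (S.C q)ᵀ * S.C q) (P * S.B q)
        ((S.B q)ᵀ * P) (-(γ ^ 2 • (1 : Matrix (Fin m) (Fin m) ℝ)))
  | .discrete =>
      Matrix.fromBlocks
        ((S.A q)ᵀ * P * S.A q + (S.C q)ᵀ * S.C q - P) ((S.A q)ᵀ * P * S.B q)
        ((S.B q)ᵀ * P * S.A q) ((S.B q)ᵀ * P * S.B q - γ ^ 2 • (1 : Matrix (Fin m) (Fin m) ℝ))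

/-- The set `G_γ(S)` of all `P > 0` with `G_γ(q, S, P) < 0` for every mode `q`. -/
def gainSet (τ : TimeAxis) (S : LSS D m p n) (γ : ℝ) : Set (Matrix (Fin n) (Fin n) ℝ) :=
  {P | P.PosDef ∧ ∀ q, (-(S.gainMatrix γ q P τ)).PosDef}

/-- `γ(S) = inf {γ > 0 | G_γ(S) ≠ ∅}`, with `inf ∅ = +∞`. -/
noncomputable def gainEstimate (τ : TimeAxis) (S : LSS D m p n) : EReal :=
  sInf ((fun γ : ℝ => (γ : EReal)) '' {γ : ℝ | 0 < γ ∧ (S.gainSet τ γ).Nonempty})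

end LSS

/-! Drive `S` and a minimal equivalent system `S'` by the same signals, and let `W` be the span of
all pairs of states reached simultaneously (`jointReachable`). `W` is invariant under the joint
dynamics, and the two outputs agree on it. Minimality makes `W` project onto the state space of `S'`
and contain no pair `(0, z)` with `z ≠ 0`; otherwise a subquotient of `S'` would be an equivalent
system of smaller dimension. So `W` is the graph of a linear surjection from a subspace of the state
space of `S`: `S'` is a quotient of a subsystem of `S`.

If `P` solves the inequalities for `S`, the quotient form on the states of `S'` solves them for
`S'`, with the same `γ`. It is `z ↦ P (L z)`, where `L z` is the point over `z` that is
`P`-orthogonal to the fibre over `0`. The next state or velocity of `S` at `L z` differs from the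
lift of that of `S'` by a vector `d` of this fibre. In continuous time `d` drops out; in discrete
time it contributes `d ⬝ᵥ P *ᵥ d ≥ 0` on the side of `S` (`gainSet_nonempty_of_relation`). Hence the
infimum for `S'` is at most that for `S`; the other claims follow by symmetry and choice.

The analysis serves the invariance of `W` in continuous time: trajectories exist, are unique and
causal, and can be prolonged by any mode and constant input, so that a right derivative gives the
velocity. -/

/-! ### Linear algebra: orthogonal sections and subquotients. -/

/-- For a positive definite form `P` and a linear relation `W` whose second projection is onto,
there is a linear section of `W` whose values are `P`-orthogonal to the fibre of `W` over `0`. -/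
theorem exists_orthogonal_section {n k : ℕ} {P : Matrix (Fin n) (Fin n) ℝ} (hP : P.PosDef)
    (W : Submodule ℝ ((Fin n → ℝ) × (Fin k → ℝ))) (hsurj : ∀ z, ∃ x, (x, z) ∈ W) :
    ∃ L : (Fin k → ℝ) →ₗ[ℝ] (Fin n → ℝ), (∀ z, (L z, z) ∈ W) ∧
      ∀ z x, (x, (0 : Fin k → ℝ)) ∈ W → L z ⬝ᵥ P *ᵥ x = 0 := by
  obtain ⟨g, hg⟩ := LinearMap.exists_rightInverse_of_surjective
    (f := (LinearMap.snd ℝ (Fin n → ℝ) (Fin k → ℝ)).comp W.subtype) (LinearMap.range_eq_top.2 fun z => by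
      obtain ⟨x, hx⟩ := hsurj z
      exact ⟨⟨(x, z), hx⟩, rfl⟩)
  let s : (Fin k → ℝ) →ₗ[ℝ] (Fin n → ℝ) := (LinearMap.fst ℝ _ _).comp (W.subtype.comp g)
  have hs : ∀ z, (s z, z) ∈ W := fun z => by
    have h1 : ((g z : (Fin n → ℝ) × (Fin k → ℝ))).2 = z := LinearMap.congr_fun hg z
    have h2 := (g z).2
    have h3 : (s z, z) = (g z : (Fin n → ℝ) × (Fin k → ℝ)) := Prod.ext rfl h1.symm
    rwa [h3]
  let M : Submodule ℝ (Fin n → ℝ) := W.comap (LinearMap.inl ℝ _ _)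
  have hM : ∀ x, x ∈ M ↔ (x, (0 : Fin k → ℝ)) ∈ W := fun x => Iff.rfl
  let β := Matrix.toBilin' P
  have hβ : ∀ x y, β x y = x ⬝ᵥ P *ᵥ y := Matrix.toBilin'_apply' P
  have hsymm : ∀ x y, β x y = β y x := fun x y => by
    have hPt : Pᵀ = P := by simpa using hP.isHermitian.eq
    rw [hβ, hβ, Matrix.dotProduct_mulVec, ← Matrix.mulVec_transpose, hPt, dotProduct_comm]
  have hcompl : IsCompl M (β.orthogonal M) := by
    refine (LinearMap.BilinForm.isCompl_orthogonal_iff_disjoint ?_).2 ?_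
    · intro x y h
      rwa [hsymm]
    · rw [Submodule.disjoint_def]
      intro x hx hx'
      by_contra hne
      have h1 := hP.dotProduct_mulVec_pos hne
      have h2 : β x x = 0 := hx' x hx
      rw [hβ] at h2
      simp only [star_trivial] at h1
      exact h1.ne' h2
  let π := M.projection _ hcompl
  -- An arbitrary section is corrected by its orthogonal projection to the fibre over `0`; this
  -- moves it only within its own fibre.
  refine ⟨s - π.comp s, fun z => ?_, fun z x hx => ?_⟩
  · have h1 : (π (s z), (0 : Fin k → ℝ)) ∈ W := (hM _).1 (Submodule.projection_apply_mem hcompl _)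
    have := W.sub_mem (hs z) h1
    simpa using this
  · rw [← hβ, hsymm]
    have h1 : s z - π (s z) ∈ β.orthogonal M := by
      rw [← Submodule.projection_apply_eq_zero_iff hcompl, map_sub]
      rw [Submodule.projection_apply_of_mem_left hcompl (Submodule.projection_apply_mem hcompl _)]
      exact sub_self _
    exact h1 x ((hM x).2 hx)

/-- For `N ≤ U`, the subquotient `U / N` in coordinates: a projection `E`, defined on the whole
space, with a section `F`. -/
theorem exists_subquotient {k : ℕ} {N U : Submodule ℝ (Fin k → ℝ)} (hNU : N ≤ U) :
    ∃ (d : ℕ) (E : (Fin k → ℝ) →ₗ[ℝ] (Fin d → ℝ)) (F : (Fin d → ℝ) →ₗ[ℝ] (Fin k → ℝ)),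
      (∀ y, E (F y) = y) ∧ (∀ y, F y ∈ U) ∧ (∀ z ∈ N, E z = 0) ∧ ∀ z ∈ U, z - F (E z) ∈ N := by
  -- `c ⊓ U` is a copy of `U / N`; enlarging `N` to a complement `K` of it yields a projection on
  -- the whole space that still kills `N`.
  obtain ⟨c, hc⟩ := Submodule.exists_isCompl N
  have hdisj : Disjoint N (c ⊓ U) := hc.disjoint.mono_right inf_le_left
  obtain ⟨K, hNK, hK⟩ := hdisj.exists_isCompl
  have hsup : U ≤ N ⊔ c ⊓ U := by
    rw [← sup_inf_assoc_of_le c hNU, hc.sup_eq_top, top_inf_eq]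
  let e : (c ⊓ U : Submodule ℝ (Fin k → ℝ)) ≃ₗ[ℝ] (Fin (Module.finrank ℝ ↥(c ⊓ U)) → ℝ) :=
    (Module.finBasis ℝ ↥(c ⊓ U)).equivFun
  refine ⟨_, e.toLinearMap.comp ((c ⊓ U).projectionOnto K hK.symm),
    (Submodule.subtype _).comp e.symm.toLinearMap, fun y => ?_, fun y => ?_, fun z hz => ?_,
    fun z hz => ?_⟩
  · simp
  · exact (e.symm y).2.2
  · simp [Submodule.projectionOnto_apply_of_mem_right hK.symm (hNK hz)]
  · obtain ⟨a, ha, b, hb, rfl⟩ := Submodule.mem_sup.1 (hsup hz)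
    have h1 := Submodule.projectionOnto_apply_of_mem_right hK.symm (hNK ha)
    have h2 := Submodule.projectionOnto_apply_of_mem_left hK.symm hb
    simp only [LinearMap.comp_apply, map_add, h1, h2]
    simpa using ha

/-! ### The gain inequality as a quadratic form, and its transport along a relation. -/

namespace LSS

variable {D m p n : ℕ}

/-- The supply-rate form of the gain matrix at state `x` and input `v`. -/
def gainForm (S : LSS D m p n) (γ : ℝ) (q : Fin D) (P : Matrix (Fin n) (Fin n) ℝ)
    (τ : TimeAxis) (x : Fin n → ℝ) (v : Fin m → ℝ) : ℝ :=
  match τ with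
  | .continuous => 2 * (x ⬝ᵥ P *ᵥ (S.A q *ᵥ x + S.B q *ᵥ v)) +
      (S.C q *ᵥ x) ⬝ᵥ (S.C q *ᵥ x) - γ ^ 2 * (v ⬝ᵥ v)
  | .discrete => (S.A q *ᵥ x + S.B q *ᵥ v) ⬝ᵥ P *ᵥ (S.A q *ᵥ x + S.B q *ᵥ v) - x ⬝ᵥ P *ᵥ x +
      (S.C q *ᵥ x) ⬝ᵥ (S.C q *ᵥ x) - γ ^ 2 * (v ⬝ᵥ v)

theorem dotProduct_transpose_mulVec {a b : ℕ} (x : Fin a → ℝ) (M : Matrix (Fin b) (Fin a) ℝ)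
    (w : Fin b → ℝ) : x ⬝ᵥ Mᵀ *ᵥ w = (M *ᵥ x) ⬝ᵥ w := by
  rw [Matrix.mulVec_transpose, dotProduct_comm, ← Matrix.dotProduct_mulVec, dotProduct_comm]

/-- The matrix inequality thus becomes a dissipation inequality: the derivative or increment of `x
⬝ᵥ P *ᵥ x`, plus output energy, minus `γ ^ 2` times input energy. -/
theorem dotProduct_gainMatrix_mulVec (S : LSS D m p n) (γ : ℝ) (q : Fin D)
    {P : Matrix (Fin n) (Fin n) ℝ} (hP : P.IsHermitian) (τ : TimeAxis)
    (x : Fin n → ℝ) (v : Fin m → ℝ) :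
    Sum.elim x v ⬝ᵥ S.gainMatrix γ q P τ *ᵥ Sum.elim x v = S.gainForm γ q P τ x v := by
  have hPt : Pᵀ = P := by simpa using hP.eq
  have hsymm : ∀ a b : Fin n → ℝ, a ⬝ᵥ P *ᵥ b = b ⬝ᵥ P *ᵥ a := fun a b => by
    conv_lhs => rw [← hPt, dotProduct_transpose_mulVec, dotProduct_comm]
  cases τ
  · simp only [gainMatrix, gainForm, Matrix.fromBlocks_mulVec, Sum.elim_comp_inl, Sum.elim_comp_inr,
      sumElim_dotProduct_sumElim, Matrix.add_mulVec, Matrix.neg_mulVec, Matrix.smul_mulVec,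
      Matrix.one_mulVec, ← Matrix.mulVec_mulVec, Matrix.mulVec_add, dotProduct_add,
      dotProduct_neg, dotProduct_smul, smul_eq_mul, dotProduct_transpose_mulVec]
    rw [hsymm (S.A q *ᵥ x) x, hsymm (S.B q *ᵥ v) x]
    ring
  · simp only [gainMatrix, gainForm, Matrix.fromBlocks_mulVec, Sum.elim_comp_inl, Sum.elim_comp_inr,
      sumElim_dotProduct_sumElim, Matrix.add_mulVec, Matrix.sub_mulVec, Matrix.smul_mulVec,
      Matrix.one_mulVec, ← Matrix.mulVec_mulVec, Matrix.mulVec_add, dotProduct_add, add_dotProduct,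
      dotProduct_sub, dotProduct_smul, smul_eq_mul, dotProduct_transpose_mulVec]
    ring

theorem isHermitian_gainMatrix (S : LSS D m p n) (γ : ℝ) (q : Fin D)
    {P : Matrix (Fin n) (Fin n) ℝ} (hP : P.IsHermitian) (τ : TimeAxis) :
    (S.gainMatrix γ q P τ).IsHermitian := by
  have hPt : Pᵀ = P := by simpa using hP.eq
  cases τ
  · refine Matrix.IsHermitian.fromBlocks ?_ ?_ ?_
    · simp [Matrix.IsHermitian, hPt, add_comm]
    · simp [hPt]
    · simp [Matrix.IsHermitian]
  · refine Matrix.IsHermitian.fromBlocks ?_ ?_ ?_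
    · simp [Matrix.IsHermitian, hPt, Matrix.mul_assoc]
    · simp [hPt, Matrix.mul_assoc]
    · simp [Matrix.IsHermitian, hPt, Matrix.mul_assoc]

theorem posDef_neg_gainMatrix_iff (S : LSS D m p n) (γ : ℝ) (q : Fin D)
    {P : Matrix (Fin n) (Fin n) ℝ} (hP : P.IsHermitian) (τ : TimeAxis) :
    (-(S.gainMatrix γ q P τ)).PosDef ↔
      ∀ x v, (x ≠ 0 ∨ v ≠ 0) → S.gainForm γ q P τ x v < 0 := by
  rw [Matrix.posDef_iff_dotProduct_mulVec]
  have key : ∀ x v, star (Sum.elim x v) ⬝ᵥ (-(S.gainMatrix γ q P τ)) *ᵥ Sum.elim x v =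
      -S.gainForm γ q P τ x v := fun x v => by
    rw [star_trivial, Matrix.neg_mulVec, dotProduct_neg, dotProduct_gainMatrix_mulVec S γ q hP τ]
  constructor
  · rintro ⟨-, h⟩ x v hxv
    have := @h (Sum.elim x v) (by
      intro h0
      rcases hxv with hx | hv
      · exact hx (funext fun i => congrFun h0 (Sum.inl i))
      · exact hv (funext fun i => congrFun h0 (Sum.inr i)))
    rw [key] at this
    linarith
  · intro h
    refine ⟨(isHermitian_gainMatrix S γ q hP τ).neg, fun w hw => ?_⟩
    obtain ⟨x, v, rfl⟩ : ∃ x v, w = Sum.elim x v := ⟨_, _, (Sum.elim_comp_inl_inr w).symm⟩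
    rw [key]
    have := h x v (by
      by_contra! h0
      apply hw
      rw [h0.1, h0.2]
      ext (i | i) <;> rfl)
    linarith

/-- A linear relation that intertwines two systems, is onto the state space of the second one and
is injective on it transports solutions of the gain inequalities. -/
theorem gainSet_nonempty_of_relation (τ : TimeAxis) {k : ℕ} (S : LSS D m p n) (S' : LSS D m p k)
    (W : Submodule ℝ ((Fin n → ℝ) × (Fin k → ℝ)))
    (hAB : ∀ w ∈ W, ∀ i v, (S.A i *ᵥ w.1 + S.B i *ᵥ v, S'.A i *ᵥ w.2 + S'.B i *ᵥ v) ∈ W)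
    (hC : ∀ w ∈ W, ∀ i, S.C i *ᵥ w.1 = S'.C i *ᵥ w.2)
    (hsurj : ∀ z, ∃ x, (x, z) ∈ W) (hinj : ∀ z, ((0 : Fin n → ℝ), z) ∈ W → z = 0) {γ : ℝ}
    (h : (S.gainSet τ γ).Nonempty) : (S'.gainSet τ γ).Nonempty := by
  obtain ⟨P, hP, hG⟩ := h
  obtain ⟨L, hLW, hLo⟩ := exists_orthogonal_section hP W hsurj
  have hLne : ∀ z, z ≠ 0 → L z ≠ 0 := fun z hz h0 => hz (hinj z (h0 ▸ hLW z))
  let Λ := LinearMap.toMatrix' L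
  have hΛ : ∀ z, Λ *ᵥ z = L z := fun z => LinearMap.toMatrix'_mulVec L z
  have hP' : (Λᵀ * P * Λ).PosDef := by
    have := hP.conjTranspose_mul_mul_same (B := Λ) (by
      intro a b hab
      simp only [hΛ] at hab
      by_contra hne
      exact hLne (a - b) (sub_ne_zero.2 hne) (by rw [map_sub, hab, sub_self]))
    simpa using this
  have hform : ∀ a b, a ⬝ᵥ (Λᵀ * P * Λ) *ᵥ b = L a ⬝ᵥ P *ᵥ L b := fun a b => by
    rw [← Matrix.mulVec_mulVec, ← Matrix.mulVec_mulVec, dotProduct_transpose_mulVec, hΛ, hΛ]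
  refine ⟨_, hP', fun q => (posDef_neg_gainMatrix_iff S' γ q hP'.isHermitian τ).2 fun z v hzv => ?_⟩
  have hneg := (posDef_neg_gainMatrix_iff S γ q hP.isHermitian τ).1 (hG q) (L z) v
    (hzv.imp (hLne z) id)
  refine lt_of_le_of_lt ?_ hneg
  -- Both vectors are paired in `W` with the same state of `S'`, so their difference lies in the
  -- fibre over `0`.
  obtain ⟨d, hd, hde⟩ : ∃ d, (d, (0 : Fin k → ℝ)) ∈ W ∧
      S.A q *ᵥ L z + S.B q *ᵥ v = L (S'.A q *ᵥ z + S'.B q *ᵥ v) + d := by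
    refine ⟨S.A q *ᵥ L z + S.B q *ᵥ v - L (S'.A q *ᵥ z + S'.B q *ᵥ v), ?_, by abel⟩
    have := W.sub_mem (hAB _ (hLW z) q v) (hLW (S'.A q *ᵥ z + S'.B q *ᵥ v))
    simpa using this
  have hCz := hC _ (hLW z) q
  cases τ
  -- The form is linear in the velocity, and `L z` is orthogonal to `d`: the two sides are equal.
  · simp only [gainForm, hform, hde, ← hCz, Matrix.mulVec_add P, dotProduct_add, hLo z d hd]
    simp
  -- The form is quadratic in the successor state; by Pythagoras the two sides differ by `d ⬝ᵥ P *ᵥ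
  -- d`.
  · have hdP : 0 ≤ d ⬝ᵥ P *ᵥ d := by simpa using hP.posSemidef.dotProduct_mulVec_nonneg d
    have hcross := hLo (S'.A q *ᵥ z + S'.B q *ᵥ v) d hd
    have hcross' : d ⬝ᵥ P *ᵥ L (S'.A q *ᵥ z + S'.B q *ᵥ v) = 0 := by
      have hPt : Pᵀ = P := by simpa using hP.isHermitian.eq
      rw [← hcross]
      conv_lhs => rw [← hPt, dotProduct_transpose_mulVec, dotProduct_comm]
    simp only [gainForm, hform, hde, ← hCz, Matrix.mulVec_add P, dotProduct_add, add_dotProduct,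
      hcross, hcross']
    linarith

end LSS

/-! ### Absolute continuity of vector-valued primitives. -/

theorem AbsolutelyContinuousOnInterval.of_dist_le {X Y : Type*} [PseudoMetricSpace X]
    [PseudoMetricSpace Y] {f : ℝ → X} {g : ℝ → Y} {a b : ℝ}
    (hg : AbsolutelyContinuousOnInterval g a b) {C : ℝ} (hC : 0 ≤ C)
    (h : ∀ x ∈ Set.uIcc a b, ∀ y ∈ Set.uIcc a b, dist (f x) (f y) ≤ C * dist (g x) (g y)) :
    AbsolutelyContinuousOnInterval f a b := by
  rw [absolutelyContinuousOnInterval_iff] at hg ⊢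
  intro ε hε
  -- Dividing by `C + 1` covers `C = 0` and leaves the final inequality strict.
  obtain ⟨δ, hδ, hd⟩ := hg (ε / (C + 1)) (by positivity)
  refine ⟨δ, hδ, fun I hI hlt => ?_⟩
  calc ∑ i ∈ Finset.range I.1, dist (f (I.2 i).1) (f (I.2 i).2)
      ≤ ∑ i ∈ Finset.range I.1, C * dist (g (I.2 i).1) (g (I.2 i).2) :=
        Finset.sum_le_sum fun i hi => h _ (hI.1 i hi).1 _ (hI.1 i hi).2
    _ = C * ∑ i ∈ Finset.range I.1, dist (g (I.2 i).1) (g (I.2 i).2) := by rw [Finset.mul_sum]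
    _ ≤ C * (ε / (C + 1)) := by gcongr; exact (hd I hI hlt).le
    _ < ε := by
      rw [mul_div_assoc', div_lt_iff₀ (by positivity)]
      nlinarith

/-- The increments are dominated by those of the real primitive of `‖f‖`. -/
theorem IntervalIntegrable.absolutelyContinuousOnInterval_primitive {F : Type*}
    [NormedAddCommGroup F] [NormedSpace ℝ F] {f : ℝ → F} {a b : ℝ}
    (h : IntervalIntegrable f volume a b) :
    AbsolutelyContinuousOnInterval (fun x => ∫ v in a..x, f v) a b := by
  refine (h.norm.absolutelyContinuousOnInterval_intervalIntegral
    Set.left_mem_uIcc).of_dist_le zero_le_one fun x hx y hy => ?_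
  have hax : IntervalIntegrable f volume a x := h.mono_set (Set.uIcc_subset_uIcc_left hx)
  have hay : IntervalIntegrable f volume a y := h.mono_set (Set.uIcc_subset_uIcc_left hy)
  rw [one_mul, dist_eq_norm, Real.dist_eq, intervalIntegral.integral_interval_sub_left hax hay,
    intervalIntegral.integral_interval_sub_left hax.norm hay.norm]
  exact intervalIntegral.norm_integral_le_abs_integral_norm

/-! ### Linear Volterra equations: uniqueness and existence. -/

section Volterra

variable {E : Type*} [NormedAddCommGroup E] [NormedSpace ℝ E]

/-- A Grönwall inequality in integral form. -/
theorem eq_zero_of_eq_integral_of_norm_le {d k : ℝ → E} (hd : Continuous d) {T M : ℝ}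
    (hM : 0 ≤ M) (heq : ∀ t ∈ Set.Icc 0 T, d t = ∫ s in (0 : ℝ)..t, k s)
    (hk : ∀ᵐ s, s ∈ Set.Ioc 0 T → ‖k s‖ ≤ M * ‖d s‖) : ∀ t ∈ Set.Icc 0 T, d t = 0 := by
  -- `G` satisfies `G' = ‖d‖ ≤ M * G` and `G 0 = 0`, hence vanishes, although `d` itself need not be
  -- differentiable.
  let G : ℝ → ℝ := fun t => ∫ s in (0 : ℝ)..t, ‖d s‖
  have hG : ∀ t, HasDerivAt G ‖d t‖ t := fun t =>
    intervalIntegral.integral_hasDerivAt_right (hd.norm.intervalIntegrable _ _)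
      (hd.norm.stronglyMeasurableAtFilter _ _) hd.norm.continuousAt
  have hle : ∀ t ∈ Set.Icc 0 T, ‖d t‖ ≤ M * G t := fun t ht => by
    rw [heq t ht]
    show _ ≤ M * ∫ s in (0 : ℝ)..t, ‖d s‖
    rw [← intervalIntegral.integral_const_mul]
    refine intervalIntegral.norm_integral_le_of_norm_le ht.1 ?_
      ((hd.norm.const_mul M).intervalIntegrable _ _)
    filter_upwards [hk] with s hs hst using hs ⟨hst.1, hst.2.trans ht.2⟩
  have hG0 : ∀ t ∈ Set.Icc 0 T, G t = 0 := by
    refine eq_zero_of_abs_deriv_le_mul_abs_self_of_eq_zero_right (K := M)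
      (fun t _ => (hG t).continuousAt.continuousWithinAt)
      (fun t _ => (hG t).hasDerivWithinAt) (by simp [G]) fun t ht => ?_
    rw [norm_norm]
    exact (hle t ⟨ht.1, ht.2.le⟩).trans (mul_le_mul_of_nonneg_left (le_abs_self _) hM)
  intro t ht
  have := hle t ht
  rw [hG0 t ht, mul_zero] at this
  exact norm_le_zero_iff.1 this

/-- Global solvability of linear Volterra equations with bounded measurable coefficients and
exponentially bounded forcing term. -/
theorem exists_eq_add_integral [CompleteSpace E] {Φ : ℝ → E →L[ℝ] E} {M : ℝ}
    (hM : ∀ t, ‖Φ t‖ ≤ M)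
    (hΦ : ∀ w : ℝ → E, Continuous w → AEStronglyMeasurable (fun t => Φ t (w t)) volume)
    {g : ℝ → E} (hg : Continuous g) {c : ℝ} (hc : 0 ≤ c)
    (hgc : ∀ t, 0 ≤ t → ‖g t‖ ≤ c * Real.exp t) :
    ∃ x : ℝ → E, Continuous x ∧ ∀ t, 0 ≤ t → x t = g t + ∫ s in (0 : ℝ)..t, Φ s (x s) := by
  have hM0 : 0 ≤ M := (norm_nonneg _).trans (hM 0)
  -- In the unknown `w t = exp (-(l * t)) • x t` the integral operator has Lipschitz constant `M /
  -- (M + 1) < 1`, and `l ≥ 1` keeps the weighted forcing term bounded by `c`.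
  set l : ℝ := M + 1 with hl
  have hl0 : 0 < l := by positivity
  have hint : ∀ w : ℝ → E, Continuous w → ∀ a b : ℝ,
      IntervalIntegrable (fun t => Φ t (w t)) volume a b := fun w hw a b => by
    refine IntervalIntegrable.mono_fun' ((hw.norm.const_mul M).intervalIntegrable a b)
      (hΦ w hw).restrict (Eventually.of_forall fun t => ?_)
    exact ((Φ t).le_opNorm _).trans (mul_le_mul_of_nonneg_right (hM t) (norm_nonneg _))
  have hexp : ∀ w : ℝ → E, Continuous w → Continuous fun s => Real.exp (l * s) • w s :=
    fun w hw => by fun_prop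
  let J : (ℝ → E) → ℝ → E := fun w t =>
    Real.exp (-(l * t)) • ∫ s in (0 : ℝ)..t, Φ s (Real.exp (l * s) • w s)
  have hJc : ∀ w, Continuous w → Continuous (J w) := fun w hw => by
    have h1 : Continuous fun t => ∫ s in (0 : ℝ)..t, Φ s (Real.exp (l * s) • w s) :=
      intervalIntegral.continuous_primitive (hint _ (hexp w hw)) 0
    exact Continuous.smul (by fun_prop) h1
  have hJb : ∀ w, Continuous w → ∀ C, (∀ s, ‖w s‖ ≤ C) → ∀ t, 0 ≤ t → ‖J w t‖ ≤ M / l * C := by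
    intro w hw C hC t ht
    have hC0 : 0 ≤ C := (norm_nonneg _).trans (hC 0)
    have h1 : ‖∫ s in (0 : ℝ)..t, Φ s (Real.exp (l * s) • w s)‖ ≤
        ∫ s in (0 : ℝ)..t, M * C * Real.exp (l * s) := by
      refine intervalIntegral.norm_integral_le_of_norm_le ht (Eventually.of_forall fun s _ => ?_)
        (Continuous.intervalIntegrable (by fun_prop) _ _)
      calc ‖Φ s (Real.exp (l * s) • w s)‖ ≤ ‖Φ s‖ * ‖Real.exp (l * s) • w s‖ := (Φ s).le_opNorm _
        _ ≤ M * (Real.exp (l * s) * C) := by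
          rw [norm_smul, Real.norm_of_nonneg (Real.exp_pos _).le]
          gcongr
          · exact hM s
          · exact hC s
        _ = M * C * Real.exp (l * s) := by ring
    have h2 : ∫ s in (0 : ℝ)..t, M * C * Real.exp (l * s) =
        M * C * ((Real.exp (l * t) - 1) / l) := by
      rw [intervalIntegral.integral_const_mul, intervalIntegral.integral_comp_mul_left _ hl0.ne',
        integral_exp]
      simp [div_eq_inv_mul]
    calc ‖J w t‖ = Real.exp (-(l * t)) * ‖∫ s in (0 : ℝ)..t, Φ s (Real.exp (l * s) • w s)‖ := by
          rw [norm_smul, Real.norm_of_nonneg (Real.exp_pos _).le]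
      _ ≤ Real.exp (-(l * t)) * (M * C * (Real.exp (l * t) / l)) := by
          gcongr
          refine h1.trans (h2.le.trans ?_)
          gcongr
          linarith
      _ = M / l * C := by
          rw [Real.exp_neg]
          field_simp
  let c₀ : ℝ → E := fun t => Real.exp (-(l * t)) • g t
  have hc₀ : Continuous c₀ := Continuous.smul (by fun_prop) hg
  have hc₀b : ∀ t, 0 ≤ t → ‖c₀ t‖ ≤ c := fun t ht => by
    rw [norm_smul, Real.norm_of_nonneg (Real.exp_pos _).le]
    calc Real.exp (-(l * t)) * ‖g t‖ ≤ Real.exp (-(l * t)) * (c * Real.exp t) := by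
          gcongr; exact hgc t ht
      _ = c * Real.exp (-(M * t)) := by
          rw [mul_left_comm, ← Real.exp_add, hl]
          ring_nf
      _ ≤ c * 1 := by
          gcongr
          rw [Real.exp_le_one_iff]
          have := mul_nonneg hM0 ht
          linarith
      _ = c := mul_one c
  -- The bounds hold only for `t ≥ 0`; clamping by `max t 0` makes the operator act on bounded
  -- continuous functions on all of `ℝ`.
  let op : BoundedContinuousFunction ℝ E → BoundedContinuousFunction ℝ E := fun w =>
    BoundedContinuousFunction.ofNormedAddCommGroup (fun t => c₀ (max t 0) + J w (max t 0))
      ((hc₀.add (hJc w w.continuous)).comp (continuous_id.max continuous_const))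
      (c + M / l * ‖w‖) fun t => (norm_add_le _ _).trans
        (add_le_add (hc₀b _ (le_max_right _ _))
          (hJb w w.continuous _ w.norm_coe_le_norm _ (le_max_right _ _)))
  obtain ⟨K, hK⟩ : ∃ K : ℝ≥0, (K : ℝ) = M / l :=
    ⟨(M / l).toNNReal, Real.coe_toNNReal _ (by positivity)⟩
  have hop : ContractingWith K op := by
    refine ⟨?_, LipschitzWith.of_dist_le_mul fun w w' => ?_⟩
    · rw [← NNReal.coe_lt_coe, hK, NNReal.coe_one, div_lt_one hl0]
      linarith
    · rw [BoundedContinuousFunction.dist_le (by positivity)]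
      intro t
      have ht : 0 ≤ max t 0 := le_max_right _ _
      have h1 : J w (max t 0) - J w' (max t 0) = J (fun s => w s - w' s) (max t 0) := by
        simp only [J]
        rw [← smul_sub, ← intervalIntegral.integral_sub (hint _ (hexp w w.continuous) _ _)
          (hint _ (hexp w' w'.continuous) _ _)]
        simp only [smul_sub, map_sub]
      have h2 : op w t - op w' t = J w (max t 0) - J w' (max t 0) := by
        show c₀ _ + _ - (c₀ _ + _) = _
        abel
      rw [dist_eq_norm, h2, h1, hK]
      refine hJb _ (w.continuous.sub w'.continuous) _ (fun s => ?_) _ ht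
      rw [Pi.sub_apply, ← dist_eq_norm]
      exact BoundedContinuousFunction.dist_coe_le_dist s
  obtain ⟨w, hw⟩ : ∃ w, op w = w := ⟨_, hop.fixedPoint_isFixedPt⟩
  refine ⟨fun t => Real.exp (l * t) • w t, hexp w w.continuous, fun t ht => ?_⟩
  have h1 : w t = c₀ t + J w t := by
    conv_lhs => rw [← hw]
    show c₀ (max t 0) + J w (max t 0) = _
    rw [max_eq_left ht]
  beta_reduce
  rw [h1, ← smul_add, smul_smul, ← Real.exp_add, add_neg_cancel, Real.exp_zero, one_smul]

/-- The right derivative of a curve in a finite dimensional subspace lies in the subspace. -/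
theorem HasDerivWithinAt.mem_submodule [FiniteDimensional ℝ E] {f : ℝ → E} {f' : E} {t : ℝ}
    (hf : HasDerivWithinAt f f' (Set.Ici t) t) (W : Submodule ℝ E) (hW : ∀ s, t ≤ s → f s ∈ W) :
    f' ∈ W := by
  rw [hasDerivWithinAt_iff_tendsto_slope] at hf
  have hne : (𝓝[Set.Ici t \ {t}] t).NeBot := by
    rw [Set.Ici_sdiff_left]; infer_instance
  refine W.closed_of_finiteDimensional.mem_of_tendsto hf ?_
  filter_upwards [self_mem_nhdsWithin] with s hs
  exact W.smul_mem _ (W.sub_mem (hW s hs.1) (hW t le_rfl))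

end Volterra

/-! ### Piecewise continuous signals. -/

section PiecewiseContinuous

variable {E : Type} [TopologicalSpace E]

theorem IsPiecewiseContinuous.countable {f : ℝ≥0 → E} (hf : IsPiecewiseContinuous f) :
    {t | ¬ ContinuousAt f t}.Countable := by
  refine (Set.countable_iUnion fun N : ℕ => (hf.1 0 N).countable).mono fun t ht => ?_
  obtain ⟨N, hN⟩ := exists_nat_ge t
  exact Set.mem_iUnion.2 ⟨N, ⟨zero_le, hN⟩, ht⟩

/-- At a continuity point a signal with discrete values is locally constant, so every level set is
open up to countably many points. -/
theorem IsPiecewiseContinuous.measurable {D : ℕ} {q : ℝ≥0 → Fin D}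
    (hq : IsPiecewiseContinuous q) : Measurable q := by
  refine measurable_to_countable' fun i => ?_
  have h : q ⁻¹' {i} = interior (q ⁻¹' {i}) ∪ (q ⁻¹' {i} ∩ {t | ¬ ContinuousAt q t}) := by
    ext t
    constructor
    · intro ht
      by_cases hc : ContinuousAt q t
      · refine Or.inl (mem_interior_iff_mem_nhds.2 (hc ?_))
        rw [nhds_discrete]
        exact ht
      · exact Or.inr ⟨ht, hc⟩
    · rintro (ht | ht)
      · exact interior_subset ht
      · exact ht.1
  rw [h]
  exact isOpen_interior.measurableSet.union
    (hq.countable.mono Set.inter_subset_right).measurableSet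

theorem IsPiecewiseContinuous.exists_tendsto_left {f : ℝ≥0 → E} (hf : IsPiecewiseContinuous f)
    (t : ℝ≥0) : ∃ l, Tendsto f (𝓝[<] t) (𝓝 l) := by
  by_cases hc : ContinuousAt f t
  · exact ⟨f t, hc.tendsto.mono_left nhdsWithin_le_nhds⟩
  · exact (hf.2 t hc).1

theorem IsPiecewiseContinuous.exists_tendsto_right {f : ℝ≥0 → E} (hf : IsPiecewiseContinuous f)
    (t : ℝ≥0) : ∃ l, Tendsto f (𝓝[>] t) (𝓝 l) := by
  by_cases hc : ContinuousAt f t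
  · exact ⟨f t, hc.tendsto.mono_left nhdsWithin_le_nhds⟩
  · exact (hf.2 t hc).2

/-- Freezing a piecewise continuous function from time `t` on. -/
theorem IsPiecewiseContinuous.ite_lt {f : ℝ≥0 → E} (hf : IsPiecewiseContinuous f) (t : ℝ≥0)
    (e : E) : IsPiecewiseContinuous fun s => if s < t then f s else e := by
  have hlt : ∀ s, s < t → (fun s => if s < t then f s else e) =ᶠ[𝓝 s] f := fun s hs => by
    filter_upwards [eventually_lt_nhds hs] with r hr using if_pos hr
  have hgt : ∀ s, t < s → (fun s => if s < t then f s else e) =ᶠ[𝓝 s] fun _ => e := fun s hs => by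
    filter_upwards [eventually_gt_nhds hs] with r hr using if_neg hr.not_gt
  constructor
  · intro a b
    refine ((hf.1 a b).union (Set.finite_singleton t)).subset fun s hs => ?_
    rcases lt_trichotomy s t with h | h | h
    · exact Or.inl ⟨hs.1, fun hc => hs.2 (hc.congr (hlt s h).symm)⟩
    · exact Or.inr h
    · exact absurd (continuousAt_const.congr (hgt s h).symm) hs.2
  · intro s _
    rcases lt_trichotomy s t with h | rfl | h
    · obtain ⟨l, hl⟩ := hf.exists_tendsto_left s
      obtain ⟨r, hr⟩ := hf.exists_tendsto_right s
      exact ⟨⟨l, hl.congr' ((hlt s h).filter_mono nhdsWithin_le_nhds).symm⟩,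
        ⟨r, hr.congr' ((hlt s h).filter_mono nhdsWithin_le_nhds).symm⟩⟩
    · obtain ⟨l, hl⟩ := hf.exists_tendsto_left s
      refine ⟨⟨l, hl.congr' ?_⟩, ⟨e, tendsto_const_nhds.congr' ?_⟩⟩
      · filter_upwards [self_mem_nhdsWithin] with r hr using (if_pos hr).symm
      · filter_upwards [self_mem_nhdsWithin] with r hr using (if_neg (not_lt_of_gt hr)).symm
    · exact ⟨⟨e, tendsto_const_nhds.congr' ((hgt s h).filter_mono nhdsWithin_le_nhds).symm⟩,
        ⟨e, tendsto_const_nhds.congr' ((hgt s h).filter_mono nhdsWithin_le_nhds).symm⟩⟩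

/-- A continuous function switched by a piecewise continuous signal is piecewise continuous. -/
theorem IsPiecewiseContinuous.switch {D : ℕ} {q : ℝ≥0 → Fin D} (hq : IsPiecewiseContinuous q)
    {g : Fin D → ℝ≥0 → E} (hg : ∀ i, Continuous (g i)) :
    IsPiecewiseContinuous fun t => g (q t) t := by
  have key : ∀ (l : Filter ℝ≥0) (t : ℝ≥0) (i : Fin D), l ≤ 𝓝 t → Tendsto q l (𝓝 i) →
      Tendsto (fun t => g (q t) t) l (𝓝 (g i t)) := fun l t i hl hi => by
    rw [nhds_discrete, tendsto_pure] at hi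
    refine (((hg i).tendsto t).mono_left hl).congr' ?_
    filter_upwards [hi] with s hs
    rw [hs]
  constructor
  · intro a b
    exact (hq.1 a b).subset fun t ht => ⟨ht.1, fun hc => ht.2 (key _ t _ le_rfl hc)⟩
  · intro t _
    obtain ⟨l, hl⟩ := hq.exists_tendsto_left t
    obtain ⟨r, hr⟩ := hq.exists_tendsto_right t
    exact ⟨⟨_, key _ t l nhdsWithin_le_nhds hl⟩, ⟨_, key _ t r nhdsWithin_le_nhds hr⟩⟩

end PiecewiseContinuous

/-! ### Regularity of states and inputs. -/

theorem IsLocallyAbsolutelyContinuous.continuous_comp_toNNReal {n : ℕ} {x : ℝ≥0 → Fin n → ℝ}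
    (hx : IsLocallyAbsolutelyContinuous x) : Continuous fun s : ℝ => x s.toNNReal := by
  have h1 : ContinuousOn (fun s : ℝ => x s.toNNReal) (Set.Ici 0) := by
    intro t ht
    have hb := (hx (t.toNNReal + 1)).continuousOn
    rw [Set.uIcc_of_le (by positivity), NNReal.coe_add, Real.coe_toNNReal _ ht] at hb
    have h2 := hb t ⟨ht, by simp⟩
    refine h2.mono_of_mem_nhdsWithin ?_
    rw [← Set.Ici_inter_Iic]
    exact inter_mem self_mem_nhdsWithin (mem_nhdsWithin_of_mem_nhds (Iic_mem_nhds (by simp)))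
  have h2 : (fun s : ℝ => x s.toNNReal) = (fun s : ℝ => x s.toNNReal) ∘ fun s => max s 0 := by
    ext1 s
    simp only [Function.comp_apply]
    congr 1
    ext
    simp [Real.coe_toNNReal']
  rw [h2]
  exact h1.comp_continuous (by fun_prop) fun s => Set.mem_Ici.2 (le_max_right _ _)

theorem IsLocallyAbsolutelyContinuous.continuous {n : ℕ} {x : ℝ≥0 → Fin n → ℝ}
    (hx : IsLocallyAbsolutelyContinuous x) : Continuous x := by
  have := hx.continuous_comp_toNNReal.comp NNReal.continuous_coe
  simpa [Function.comp_def] using this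

theorem Matrix.exists_norm_mulVec_le {ι : Type*} [Fintype ι] {a b : ℕ}
    (A : ι → Matrix (Fin a) (Fin b) ℝ) :
    ∃ M : ℝ, 0 ≤ M ∧ ∀ i v, ‖A i *ᵥ v‖ ≤ M * ‖v‖ := by
  refine ⟨∑ i, ‖(Matrix.toLin' (A i)).toContinuousLinearMap‖,
    Finset.sum_nonneg fun i _ => norm_nonneg _, fun i v => ?_⟩
  refine ((Matrix.toLin' (A i)).toContinuousLinearMap.le_opNorm v).trans ?_
  gcongr
  exact Finset.single_le_sum (f := fun i => ‖(Matrix.toLin' (A i)).toContinuousLinearMap‖)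
    (fun i _ => norm_nonneg _) (Finset.mem_univ i)

theorem Matrix.continuous_mulVec_const {a b : ℕ} (A : Matrix (Fin a) (Fin b) ℝ) :
    Continuous fun v : Fin b → ℝ => A *ᵥ v :=
  (Matrix.toLin' A).toContinuousLinearMap.continuous

theorem aestronglyMeasurable_switch_mulVec {D a b : ℕ} (A : Fin D → Matrix (Fin a) (Fin b) ℝ)
    {q : ℝ≥0 → Fin D} (hq : IsPiecewiseContinuous q) {μ : Measure ℝ} {w : ℝ → Fin b → ℝ}
    (hw : AEStronglyMeasurable w μ) :
    AEStronglyMeasurable (fun t : ℝ => A (q t.toNNReal) *ᵥ w t) μ := by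
  have h1 : Measurable fun z : (Fin b → ℝ) × Fin D => A z.2 *ᵥ z.1 :=
    measurable_from_prod_countable_left fun i => (Matrix.continuous_mulVec_const (A i)).measurable
  have h2 : AEMeasurable (fun t : ℝ => (w t, q t.toNNReal)) μ :=
    hw.aemeasurable.prodMk (hq.measurable.comp measurable_real_toNNReal).aemeasurable
  exact (h1.comp_aemeasurable h2).aestronglyMeasurable

/-- Square integrable inputs are integrable on bounded intervals, and their primitives grow at most
linearly. -/
theorem IsInput.exists_bound {m : ℕ} {u : ℝ≥0 → Fin m → ℝ} (hu : IsInput .continuous u) :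
    AEStronglyMeasurable (fun t : ℝ => u t.toNNReal) (volume.restrict (Set.Ici 0)) ∧
    ∃ g : ℝ → ℝ, (∀ t, ‖u t.toNNReal‖ ≤ g t) ∧ (∀ T, IntegrableOn g (Set.Icc 0 T)) ∧
      ∃ c, 0 ≤ c ∧ ∀ t, 0 ≤ t → ∫ s in (0 : ℝ)..t, g s ≤ c * Real.exp t := by
  have hu' : MemLp (fun t : ℝ => WithLp.toLp 2 (u t.toNNReal)) 2 (volume.restrict (Set.Ici 0)) := hu
  refine ⟨(PiLp.continuous_ofLp 2 (fun _ : Fin m => ℝ)).comp_aestronglyMeasurable hu'.1, ?_⟩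
  have hsq : IntegrableOn (fun t : ℝ => ‖WithLp.toLp 2 (u t.toNNReal)‖ ^ 2) (Set.Ici 0) :=
    hu'.integrable_norm_pow two_ne_zero
  set N : ℝ → ℝ := fun t => ‖WithLp.toLp 2 (u t.toNNReal)‖ ^ 2 with hN
  have hN0 : ∀ t, 0 ≤ N t := fun t => by positivity
  have hNi : ∀ T, IntegrableOn N (Set.Icc 0 T) := fun T => hsq.mono_set Set.Icc_subset_Ici_self
  -- Since `a ≤ 1 + a ^ 2`, the norm is dominated by `1 + N`, whose integral over `[0, t]` is at
  -- most `t` plus the total energy.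
  refine ⟨fun t => 1 + N t, fun t => ?_, fun T => ?_, 1 + ∫ t in Set.Ici 0, N t, ?_, fun t ht => ?_⟩
  · have h1 : ‖u t.toNNReal‖ ≤ ‖WithLp.toLp 2 (u t.toNNReal)‖ :=
      (pi_norm_le_iff_of_nonneg (norm_nonneg _)).2 fun i =>
        PiLp.norm_apply_le (WithLp.toLp 2 (u t.toNNReal)) i
    show _ ≤ 1 + ‖WithLp.toLp 2 (u t.toNNReal)‖ ^ 2
    nlinarith [sq_nonneg (‖WithLp.toLp 2 (u t.toNNReal)‖ - 1)]
  · exact (integrableOn_const (by simp)).add (hNi T)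
  · have : 0 ≤ ∫ t in Set.Ici 0, N t := integral_nonneg hN0
    linarith
  · have hI : 0 ≤ ∫ t in Set.Ici 0, N t := integral_nonneg hN0
    have h1 : ∫ s in (0 : ℝ)..t, N s ≤ ∫ t in Set.Ici 0, N t := by
      rw [intervalIntegral.integral_of_le ht]
      exact setIntegral_mono_set hsq (Eventually.of_forall hN0)
        (Set.Ioc_subset_Icc_self.trans Set.Icc_subset_Ici_self).eventuallyLE
    rw [intervalIntegral.integral_add (by simp)
      ((intervalIntegrable_iff_integrableOn_Icc_of_le ht).2 (hNi t))]
    have h2 := Real.add_one_le_exp t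
    have h3 : (∫ t in Set.Ici 0, N t) * 1 ≤ (∫ t in Set.Ici 0, N t) * Real.exp t := by
      gcongr
      linarith
    simp only [intervalIntegral.integral_const, smul_eq_mul, mul_one, sub_zero]
    nlinarith

/-- Modifying an input from time `t` on: constant on `[t, t + 1)` and zero afterwards. -/
theorem IsInput.ite_lt {m : ℕ} {u : ℝ≥0 → Fin m → ℝ} (hu : IsInput .continuous u) (t : ℝ≥0)
    (v : Fin m → ℝ) :
    IsInput .continuous fun s : ℝ≥0 => if s < t then u s else if s < t + 1 then v else 0 := by
  have hu' : MemLp (fun t : ℝ => WithLp.toLp 2 (u t.toNNReal)) 2 (volume.restrict (Set.Ici 0)) := hu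
  have h1 : MeasurableSet (Real.toNNReal ⁻¹' Set.Iio t) :=
    measurable_real_toNNReal measurableSet_Iio
  have h2 : MeasurableSet (Real.toNNReal ⁻¹' Set.Ico t (t + 1)) :=
    measurable_real_toNNReal measurableSet_Ico
  have h3 : volume.restrict (Set.Ici (0 : ℝ)) (Real.toNNReal ⁻¹' Set.Ico t (t + 1)) ≠ ⊤ := by
    rw [Measure.restrict_apply h2]
    refine ((measure_mono ?_).trans_lt (measure_Icc_lt_top (a := (0 : ℝ)) (b := t + 1))).ne
    rintro s ⟨hs, hs0⟩
    refine ⟨hs0, ?_⟩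
    have := NNReal.coe_lt_coe.2 hs.2
    rw [Real.coe_toNNReal _ hs0] at this
    exact_mod_cast this.le
  -- The cut-off at `t + 1` confines the constant `v` to a set of finite measure, which keeps the
  -- input square integrable.
  have h4 := (hu'.indicator h1).add
    (memLp_indicator_const 2 h2 (WithLp.toLp 2 v) (Or.inr h3))
  refine (congrArg (fun f => MemLp f 2 (volume.restrict (Set.Ici (0 : ℝ)))) (funext fun s => ?_)).mp h4
  simp only [Pi.add_apply]
  by_cases ha : s.toNNReal < t
  · simp [ha]
  · by_cases hb : s.toNNReal < t + 1
    · simp [ha, hb, not_lt.1 ha]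
    · simp [ha, hb]

/-! ### State trajectories: existence, uniqueness, causality, prolongation. -/

namespace LSS

variable {D m p n k : ℕ}

/-- `x` is the state trajectory of `S` with zero initial state relative to `(u, q)`. -/
def IsStateTrajectory (S : LSS D m p n) : (τ : TimeAxis) →
    (u : τ.Time → Fin m → ℝ) → (q : τ.Time → Fin D) → (x : τ.Time → Fin n → ℝ) → Prop
  | .continuous, u, q, x =>
      IsLocallyAbsolutelyContinuous x ∧ x 0 = 0 ∧
      ∀ᵐ t ∂(volume.restrict (Set.Ici (0 : ℝ))), HasDerivAt (fun s : ℝ => x s.toNNReal)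
        (S.A (q t.toNNReal) *ᵥ x t.toNNReal + S.B (q t.toNNReal) *ᵥ u t.toNNReal) t
  | .discrete, u, q, x =>
      x 0 = 0 ∧ ∀ t : ℕ, x (t + 1) = S.A (q t) *ᵥ x t + S.B (q t) *ᵥ u t

/-- Piecewise continuity of the output is automatic, as the state is continuous and the signal
piecewise continuous. -/
theorem isSolution_zero_iff (S : LSS D m p n) (τ : TimeAxis) {u : τ.Time → Fin m → ℝ}
    {q : τ.Time → Fin D} (hq : IsSwitchingSignal τ q) {x : τ.Time → Fin n → ℝ}
    {y : τ.Time → Fin p → ℝ} :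
    S.IsSolution 0 τ u q x y ↔ S.IsStateTrajectory τ u q x ∧ ∀ t, y t = S.C (q t) *ᵥ x t := by
  cases τ
  · constructor
    · rintro ⟨h1, -, h2, h3, h4⟩
      exact ⟨⟨h1, h2, h3⟩, h4⟩
    · rintro ⟨⟨h1, h2, h3⟩, h4⟩
      refine ⟨h1, ?_, h2, h3, h4⟩
      have h5 : IsPiecewiseContinuous fun t => S.C (q t) *ᵥ x t :=
        IsPiecewiseContinuous.switch hq
          fun i => (Matrix.continuous_mulVec_const (S.C i)).comp h1.continuous
      rwa [show y = fun t => S.C (q t) *ᵥ x t from funext h4]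
  · exact and_assoc.symm

/-- Right-hand side of the continuous-time state equation along `x`. -/
def velocity (S : LSS D m p n) (u : ℝ≥0 → Fin m → ℝ) (q : ℝ≥0 → Fin D) (x : ℝ≥0 → Fin n → ℝ)
    (t : ℝ) : Fin n → ℝ :=
  S.A (q t.toNNReal) *ᵥ x t.toNNReal + S.B (q t.toNNReal) *ᵥ u t.toNNReal

section Continuous

variable {S : LSS D m p n} {u u' : ℝ≥0 → Fin m → ℝ} {q q' : ℝ≥0 → Fin D} {x x' : ℝ≥0 → Fin n → ℝ}

theorem integrableOn_input_term (S : LSS D m p n) (hu : IsInput .continuous u)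
    (hq : IsPiecewiseContinuous q) (T : ℝ) :
    IntegrableOn (fun t : ℝ => S.B (q t.toNNReal) *ᵥ u t.toNNReal) (Set.Icc 0 T) := by
  obtain ⟨hmeas, g, hg, hgi, -⟩ := hu.exists_bound
  obtain ⟨M, hM0, hM⟩ := Matrix.exists_norm_mulVec_le S.B
  refine Integrable.mono' ((hgi T).const_mul M)
    ((aestronglyMeasurable_switch_mulVec S.B hq hmeas).mono_set Set.Icc_subset_Ici_self)
    (Eventually.of_forall fun t => ?_)
  exact (hM _ _).trans (mul_le_mul_of_nonneg_left (hg t) hM0)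

theorem integrableOn_velocity (S : LSS D m p n) (hu : IsInput .continuous u)
    (hq : IsPiecewiseContinuous q) (hx : Continuous fun s : ℝ => x s.toNNReal) (T : ℝ) :
    IntegrableOn (S.velocity u q x) (Set.Icc 0 T) := by
  obtain ⟨M, hM0, hM⟩ := Matrix.exists_norm_mulVec_le S.A
  refine Integrable.add ?_ (S.integrableOn_input_term hu hq T)
  refine Integrable.mono' ((hx.norm.const_mul M).continuousOn.integrableOn_Icc)
    (aestronglyMeasurable_switch_mulVec S.A hq hx.aestronglyMeasurable)
    (Eventually.of_forall fun t => ?_)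
  exact hM _ _

theorem intervalIntegrable_velocity (S : LSS D m p n) (hu : IsInput .continuous u)
    (hq : IsPiecewiseContinuous q) (hx : Continuous fun s : ℝ => x s.toNNReal) {a b : ℝ}
    (ha : 0 ≤ a) (hb : 0 ≤ b) : IntervalIntegrable (S.velocity u q x) volume a b := by
  rw [intervalIntegrable_iff]
  refine (S.integrableOn_velocity hu hq hx (max a b)).mono_set fun s hs => ?_
  rw [Set.uIoc, Set.mem_Ioc] at hs
  exact ⟨(le_min ha hb).trans hs.1.le, hs.2⟩

/-- The state minus the primitive of its velocity is absolutely continuous with derivative zero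
almost everywhere, hence constant. -/
theorem IsStateTrajectory.eq_integral (h : S.IsStateTrajectory .continuous u q x)
    (hu : IsInput .continuous u) (hq : IsPiecewiseContinuous q) {t : ℝ} (ht : 0 ≤ t) :
    x t.toNNReal = ∫ s in (0 : ℝ)..t, S.velocity u q x s := by
  obtain ⟨hac, h0, hd⟩ := h
  have hint := S.intervalIntegrable_velocity hu hq hac.continuous_comp_toNNReal le_rfl ht
  have hac' := hac t.toNNReal
  rw [Real.coe_toNNReal _ ht] at hac'
  have hd' := (ae_restrict_iff' measurableSet_Ici).1 hd
  obtain ⟨c, hc⟩ := (hac'.sub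
    hint.absolutelyContinuousOnInterval_primitive).const_of_ae_hasDerivAt_zero (by
      filter_upwards [hd', hint.ae_hasDerivAt_integral] with s h1 h2 hs
      have hs0 : 0 ≤ s := by
        rw [Set.uIcc_of_le ht] at hs
        exact hs.1
      have h3 := (h1 hs0).sub (h2 hs 0 Set.left_mem_uIcc)
      rwa [show S.A (q s.toNNReal) *ᵥ x s.toNNReal + S.B (q s.toNNReal) *ᵥ u s.toNNReal -
        S.velocity u q x s = 0 from sub_self _] at h3)
  have hc0 := hc 0 Set.left_mem_uIcc
  have hct := hc t Set.right_mem_uIcc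
  simp only [Pi.sub_apply, Real.toNNReal_zero, h0, intervalIntegral.integral_same, sub_zero] at hc0
  rw [← hc0] at hct
  exact sub_eq_zero.1 hct

/-- Causality: before `T` the inputs cancel in the difference of the states, and Grönwall applies.
-/
theorem IsStateTrajectory.eq_of_eqOn_continuous (h : S.IsStateTrajectory .continuous u q x)
    (h' : S.IsStateTrajectory .continuous u' q' x') (hu : IsInput .continuous u)
    (hu' : IsInput .continuous u') (hq : IsPiecewiseContinuous q) (hq' : IsPiecewiseContinuous q')
    {T : ℝ≥0} (huu : ∀ t < T, u t = u' t) (hqq : ∀ t < T, q t = q' t) : x T = x' T := by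
  have hx := h.1.continuous_comp_toNNReal
  have hx' := h'.1.continuous_comp_toNNReal
  obtain ⟨M, hM0, hM⟩ := Matrix.exists_norm_mulVec_le S.A
  have hzero := eq_zero_of_eq_integral_of_norm_le (d := fun s : ℝ => x s.toNNReal - x' s.toNNReal)
    (k := fun s => S.velocity u q x s - S.velocity u' q' x' s) (hx.sub hx') (T := T) hM0
    (fun t ht => by
      rw [h.eq_integral hu hq ht.1, h'.eq_integral hu' hq' ht.1, intervalIntegral.integral_sub
        (S.intervalIntegrable_velocity hu hq hx le_rfl ht.1)
        (S.intervalIntegrable_velocity hu' hq' hx' le_rfl ht.1)])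
    (by
      -- The signals agree only strictly before `T`; the endpoint is a null set.
      have hne : ∀ᵐ s : ℝ, s ≠ T := by simp [ae_iff, measure_singleton]
      filter_upwards [hne] with s hs hsT
      have hlt : s.toNNReal < T := by
        rw [← NNReal.coe_lt_coe, Real.coe_toNNReal _ hsT.1.le]
        exact lt_of_le_of_ne hsT.2 hs
      have : S.velocity u q x s - S.velocity u' q' x' s =
          S.A (q s.toNNReal) *ᵥ (x s.toNNReal - x' s.toNNReal) := by
        rw [velocity, velocity, ← huu _ hlt, ← hqq _ hlt, Matrix.mulVec_sub]
        abel
      rw [this]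
      exact hM _ _)
  have := hzero T ⟨T.2, le_rfl⟩
  simpa [sub_eq_zero] using this

theorem exists_isStateTrajectory_continuous (S : LSS D m p n) (hu : IsInput .continuous u)
    (hq : IsPiecewiseContinuous q) : ∃ x, S.IsStateTrajectory .continuous u q x := by
  obtain ⟨hmeas, g, hg, hgi, c, hc0, hc⟩ := hu.exists_bound
  obtain ⟨M, hM0, hM⟩ := Matrix.exists_norm_mulVec_le S.A
  obtain ⟨K, hK0, hK⟩ := Matrix.exists_norm_mulVec_le S.B
  let f : ℝ → Fin n → ℝ :=
    (Set.Ici (0 : ℝ)).indicator fun t => S.B (q t.toNNReal) *ᵥ u t.toNNReal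
  have hfi : ∀ a b, IntervalIntegrable f volume a b := fun a b => by
    rw [intervalIntegrable_iff, IntegrableOn, integrable_indicator_iff measurableSet_Ici,
      IntegrableOn, Measure.restrict_restrict measurableSet_Ici]
    exact (S.integrableOn_input_term hu hq (max a b)).mono_set fun s hs => ⟨hs.1, hs.2.2⟩
  obtain ⟨X, hX, hXeq⟩ := exists_eq_add_integral (E := Fin n → ℝ)
    (Φ := fun t : ℝ => (Matrix.toLin' (S.A (q t.toNNReal))).toContinuousLinearMap) (M := M)
    (fun t => ContinuousLinearMap.opNorm_le_bound _ hM0 fun w => hM _ w)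
    (fun w hw => aestronglyMeasurable_switch_mulVec S.A hq hw.aestronglyMeasurable)
    (g := fun t => ∫ s in (0 : ℝ)..t, f s) (intervalIntegral.continuous_primitive hfi 0)
    (c := K * c) (by positivity) (fun t ht => by
      calc ‖∫ s in (0 : ℝ)..t, f s‖ ≤ ∫ s in (0 : ℝ)..t, K * g s := by
            refine intervalIntegral.norm_integral_le_of_norm_le ht
              (Eventually.of_forall fun s hs => ?_)
              (((intervalIntegrable_iff_integrableOn_Icc_of_le ht).2 (hgi t)).const_mul K)
            rw [show f s = S.B (q s.toNNReal) *ᵥ u s.toNNReal from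
              Set.indicator_of_mem (Set.mem_Ici.2 hs.1.le) _]
            exact (hK _ _).trans (mul_le_mul_of_nonneg_left (hg s) hK0)
        _ ≤ K * c * Real.exp t := by
            rw [intervalIntegral.integral_const_mul, mul_assoc]
            exact mul_le_mul_of_nonneg_left (hc t ht) hK0)
  let x : ℝ≥0 → Fin n → ℝ := fun t => X t
  have hxX : ∀ t : ℝ, 0 ≤ t → x t.toNNReal = X t := fun t ht => by
    simp only [x, Real.coe_toNNReal _ ht]
  have hxc : Continuous fun s : ℝ => x s.toNNReal :=
    hX.comp (NNReal.continuous_coe.comp continuous_real_toNNReal)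
  have hint : ∀ t : ℝ, 0 ≤ t → IntervalIntegrable (S.velocity u q x) volume 0 t := fun t ht =>
    S.intervalIntegrable_velocity hu hq hxc le_rfl ht
  have heq : ∀ t : ℝ, 0 ≤ t → x t.toNNReal = ∫ s in (0 : ℝ)..t, S.velocity u q x s := by
    intro t ht
    have hfv : ∀ s ∈ Set.uIcc 0 t, f s + S.A (q s.toNNReal) *ᵥ X s = S.velocity u q x s := by
      intro s hs
      rw [Set.uIcc_of_le ht] at hs
      rw [velocity, hxX s hs.1, add_comm]
      congr 1
      exact Set.indicator_of_mem (Set.mem_Ici.2 hs.1) _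
    have hAi : IntervalIntegrable (fun s => S.A (q s.toNNReal) *ᵥ X s) volume 0 t := by
      refine ((hint t ht).sub (hfi 0 t)).congr fun s hs => ?_
      rw [← hfv s (Set.uIoc_subset_uIcc hs)]
      exact add_sub_cancel_left _ _
    rw [hxX t ht, hXeq t ht, ← intervalIntegral.integral_congr hfv]
    exact (intervalIntegral.integral_add (hfi 0 t) hAi).symm
  refine ⟨x, fun b => ?_, ?_, ?_⟩
  · refine (hint b b.coe_nonneg).absolutelyContinuousOnInterval_primitive.of_dist_le zero_le_one
      fun s hs t ht => ?_
    rw [Set.uIcc_of_le b.coe_nonneg] at hs ht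
    rw [one_mul, heq s hs.1, heq t ht.1]
  · simpa using heq 0 le_rfl
  · rw [ae_restrict_iff' measurableSet_Ici]
    -- Lebesgue differentiation is applied on the countably many intervals `[0, N]`. The point `0`
    -- is discarded because the integral equation holds on one side of it only.
    have hne : ∀ᵐ s : ℝ, s ≠ 0 := by simp [ae_iff, measure_singleton]
    have hall : ∀ᵐ s : ℝ, ∀ N : ℕ, s ∈ Set.uIcc (0 : ℝ) N → ∀ c ∈ Set.uIcc (0 : ℝ) N,
        HasDerivAt (fun r => ∫ t in c..r, S.velocity u q x t) (S.velocity u q x s) s :=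
      ae_all_iff.2 fun N => (hint N N.cast_nonneg).ae_hasDerivAt_integral
    filter_upwards [hne, hall] with s hs0 hs hsp
    have hpos : 0 < s := lt_of_le_of_ne hsp hs0.symm
    obtain ⟨N, hN⟩ := exists_nat_ge s
    refine (hs N (by rw [Set.uIcc_of_le N.cast_nonneg]; exact ⟨hsp, hN⟩) 0
      Set.left_mem_uIcc).congr_of_eventuallyEq ?_
    filter_upwards [eventually_gt_nhds hpos] with r hr using heq r hr.le

/-- If input and mode are constant on `[t, t + 1)`, the state has the expected right derivative
at `t`. -/
theorem IsStateTrajectory.hasDerivWithinAt (h : S.IsStateTrajectory .continuous u q x)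
    (hu : IsInput .continuous u) (hq : IsPiecewiseContinuous q) {t : ℝ≥0} {i : Fin D}
    {v : Fin m → ℝ} (hui : ∀ s, t ≤ s → s < t + 1 → u s = v)
    (hqi : ∀ s, t ≤ s → s < t + 1 → q s = i) :
    HasDerivWithinAt (fun s : ℝ => x s.toNNReal) (S.A i *ᵥ x t + S.B i *ᵥ v) (Set.Ici (t : ℝ)) t := by
  have hx := h.1.continuous_comp_toNNReal
  -- `κ` is continuous and equals the velocity on `[t, t + 1)`, so the fundamental theorem of
  -- calculus holds at `t` itself.
  let κ : ℝ → Fin n → ℝ := fun s => S.A i *ᵥ x s.toNNReal + S.B i *ᵥ v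
  have hκ : Continuous κ :=
    ((Matrix.continuous_mulVec_const (S.A i)).comp hx).add continuous_const
  have h1 : HasDerivAt (fun s => x t + ∫ r in (t : ℝ)..s, κ r) (κ t) t :=
    (intervalIntegral.integral_hasDerivAt_right (hκ.intervalIntegrable _ _)
      (hκ.stronglyMeasurableAtFilter _ _) hκ.continuousAt).const_add _
  have h2 : κ t = S.A i *ᵥ x t + S.B i *ᵥ v := by simp [κ]
  rw [← h2]
  have heq : ∀ s : ℝ, t ≤ s → s < t + 1 →
      x s.toNNReal = x t + ∫ r in (t : ℝ)..s, κ r := fun s hs hs1 => by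
    have hs0 : 0 ≤ s := t.coe_nonneg.trans hs
    have h3 : ∫ r in (t : ℝ)..s, κ r = ∫ r in (t : ℝ)..s, S.velocity u q x r := by
      refine intervalIntegral.integral_congr fun r hr => ?_
      rw [Set.uIcc_of_le hs] at hr
      have hr0 : 0 ≤ r := t.coe_nonneg.trans hr.1
      have hr1 : t ≤ r.toNNReal := NNReal.le_toNNReal_of_coe_le hr.1
      have hr2 : r.toNNReal < t + 1 := by
        rw [← NNReal.coe_lt_coe, Real.coe_toNNReal _ hr0]
        exact hr.2.trans_lt hs1
      simp only [κ, velocity, hui _ hr1 hr2, hqi _ hr1 hr2]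
    have h4 := h.eq_integral hu hq (t := t) t.coe_nonneg
    rw [Real.toNNReal_coe] at h4
    rw [h3, h4, h.eq_integral hu hq hs0, intervalIntegral.integral_add_adjacent_intervals
      (S.intervalIntegrable_velocity hu hq hx le_rfl t.coe_nonneg)
      (S.intervalIntegrable_velocity hu hq hx t.coe_nonneg hs0)]
  refine h1.hasDerivWithinAt.congr_of_eventuallyEq ?_ ?_
  · filter_upwards [self_mem_nhdsWithin,
      mem_nhdsWithin_of_mem_nhds (eventually_lt_nhds (lt_add_one (t : ℝ)))] with s hs hs1
      using heq s hs hs1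
  · exact heq t le_rfl (lt_add_one _)

end Continuous

theorem exists_isStateTrajectory (S : LSS D m p n) (τ : TimeAxis) {u : τ.Time → Fin m → ℝ}
    {q : τ.Time → Fin D} (hu : IsInput τ u) (hq : IsSwitchingSignal τ q) :
    ∃ x, S.IsStateTrajectory τ u q x := by
  cases τ
  · exact S.exists_isStateTrajectory_continuous hu hq
  · exact ⟨fun t => Nat.rec 0 (fun t x => S.A (q t) *ᵥ x + S.B (q t) *ᵥ u t) t, rfl, fun _ => rfl⟩

theorem IsStateTrajectory.unique {S : LSS D m p n} {τ : TimeAxis} {u : τ.Time → Fin m → ℝ}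
    {q : τ.Time → Fin D} {x x' : τ.Time → Fin n → ℝ} (hu : IsInput τ u)
    (hq : IsSwitchingSignal τ q) (h : S.IsStateTrajectory τ u q x)
    (h' : S.IsStateTrajectory τ u q x') : x = x' := by
  cases τ
  · exact funext fun t => h.eq_of_eqOn_continuous h' hu hu hq hq (fun _ _ => rfl) fun _ _ => rfl
  · funext t
    induction t with
    | zero => rw [h.1, h'.1]
    | succ t ih => rw [h.2, h'.2, ih]

theorem IsStateTrajectory.eq_of_eqOn_discrete {S : LSS D m p n} {u u' : ℕ → Fin m → ℝ}
    {q q' : ℕ → Fin D} {x x' : ℕ → Fin n → ℝ} (h : S.IsStateTrajectory .discrete u q x)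
    (h' : S.IsStateTrajectory .discrete u' q' x') {T : ℕ} (huu : ∀ t < T, u t = u' t)
    (hqq : ∀ t < T, q t = q' t) : x T = x' T := by
  induction T with
  | zero => rw [h.1, h'.1]
  | succ T ih =>
    rw [h.2, h'.2, ih (fun t ht => huu t (ht.trans T.lt_succ_self))
      (fun t ht => hqq t (ht.trans T.lt_succ_self)), huu T T.lt_succ_self, hqq T T.lt_succ_self]

/-- The image of a trajectory under a linear map that intertwines the dynamics along it. -/
theorem IsStateTrajectory.map {S : LSS D m p n} {S' : LSS D m p k} {τ : TimeAxis}
    {u : τ.Time → Fin m → ℝ} {q : τ.Time → Fin D} {x : τ.Time → Fin n → ℝ}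
    (h : S.IsStateTrajectory τ u q x) (E : (Fin n → ℝ) →ₗ[ℝ] (Fin k → ℝ))
    (hE : ∀ t i v, E (S.A i *ᵥ x t + S.B i *ᵥ v) = S'.A i *ᵥ E (x t) + S'.B i *ᵥ v) :
    S'.IsStateTrajectory τ u q fun t => E (x t) := by
  cases τ
  · obtain ⟨hac, h0, hd⟩ := h
    refine ⟨fun b => ?_, ?_, ?_⟩
    · refine (hac b).of_dist_le (norm_nonneg E.toContinuousLinearMap) fun s _ t _ => ?_
      rw [dist_eq_norm, dist_eq_norm, ← map_sub]
      exact E.toContinuousLinearMap.le_opNorm _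
    · exact (congrArg E h0).trans (map_zero E)
    · filter_upwards [hd] with t ht
      rw [← hE]
      exact (E.toContinuousLinearMap.hasFDerivAt (x := x t.toNNReal)).comp_hasDerivAt t ht
  · exact ⟨(congrArg E h.1).trans (map_zero E), fun t => (congrArg E (h.2 t)).trans (hE t _ _)⟩

/-- From any time on, the input can be prolonged by an arbitrary value and the switching signal by
an arbitrary mode; a subspace that contains the prolonged pair of trajectories then contains the
corresponding velocity (or successor state). -/
theorem IsStateTrajectory.exists_prolongation {S : LSS D m p n} {S' : LSS D m p k} {τ : TimeAxis}
    {u : τ.Time → Fin m → ℝ} {q : τ.Time → Fin D} {x : τ.Time → Fin n → ℝ}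
    {z : τ.Time → Fin k → ℝ} (hu : IsInput τ u) (hq : IsSwitchingSignal τ q)
    (hx : S.IsStateTrajectory τ u q x) (hz : S'.IsStateTrajectory τ u q z) (t : τ.Time)
    (i : Fin D) (v : Fin m → ℝ) :
    ∃ u' q' x' z', IsInput τ u' ∧ IsSwitchingSignal τ q' ∧ S.IsStateTrajectory τ u' q' x' ∧
      S'.IsStateTrajectory τ u' q' z' ∧ x' t = x t ∧ z' t = z t ∧ q' t = i ∧
      ∀ W : Submodule ℝ ((Fin n → ℝ) × (Fin k → ℝ)), (∀ s, (x' s, z' s) ∈ W) →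
        (S.A i *ᵥ x t + S.B i *ᵥ v, S'.A i *ᵥ z t + S'.B i *ᵥ v) ∈ W := by
  cases τ
  · have hu' := IsInput.ite_lt hu t v
    have hq' := IsPiecewiseContinuous.ite_lt hq t i
    obtain ⟨x', hx'⟩ := S.exists_isStateTrajectory .continuous hu' hq'
    obtain ⟨z', hz'⟩ := S'.exists_isStateTrajectory .continuous hu' hq'
    have hxt : x' t = x t := hx'.eq_of_eqOn_continuous hx hu' hu hq' hq
      (fun s hs => if_pos hs) fun s hs => if_pos hs
    have hzt : z' t = z t := hz'.eq_of_eqOn_continuous hz hu' hu hq' hq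
      (fun s hs => if_pos hs) fun s hs => if_pos hs
    refine ⟨_, _, x', z', hu', hq', hx', hz', hxt, hzt, if_neg (lt_irrefl t), fun W hW => ?_⟩
    have hui : ∀ s : ℝ≥0, t ≤ s → s < t + 1 →
        (if s < t then u s else if s < t + 1 then v else 0) = v := fun s h1 h2 => by
      rw [if_neg h1.not_gt, if_pos h2]
    have hqi : ∀ s : ℝ≥0, t ≤ s → s < t + 1 → (if s < t then q s else i) = i :=
      fun s h1 _ => if_neg h1.not_gt
    have h1 := (hx'.hasDerivWithinAt hu' hq' hui hqi).prodMk
      (hz'.hasDerivWithinAt hu' hq' hui hqi)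
    rw [hxt, hzt] at h1
    exact h1.mem_submodule W fun s _ => hW s.toNNReal
  · let u' : ℕ → Fin m → ℝ := fun s => if s < t then u s else if s = t then v else 0
    let q' : ℕ → Fin D := fun s => if s < t then q s else i
    have hu' : IsInput .discrete u' := by
      -- The prolonged input has finite support.
      refine (memℓp_zero ((Set.finite_le_nat t).subset fun s hs => ?_)).of_exponent_ge zero_le
      by_contra hlt
      simp only [Set.mem_ofPred_eq, not_le] at hlt
      exact hs (by simp [u', hlt.not_gt, hlt.ne'])
    obtain ⟨x', hx'⟩ := S.exists_isStateTrajectory .discrete hu' (q := q') trivial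
    obtain ⟨z', hz'⟩ := S'.exists_isStateTrajectory .discrete hu' (q := q') trivial
    have hxt : x' t = x t := hx'.eq_of_eqOn_discrete hx
      (fun s hs => if_pos hs) fun s hs => if_pos hs
    have hzt : z' t = z t := hz'.eq_of_eqOn_discrete hz
      (fun s hs => if_pos hs) fun s hs => if_pos hs
    have hqt : q' t = i := if_neg (lt_irrefl t)
    have hut : u' t = v := by simp [u']
    refine ⟨u', q', x', z', hu', trivial, hx', hz', hxt, hzt, hqt, fun W hW => ?_⟩
    have h1 := hW (t + 1)
    rwa [hx'.2, hz'.2, hxt, hzt, hqt, hut] at h1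

end LSS

/-! ### The joint reachable space and minimality. -/

namespace LSS

variable {D m p n k : ℕ}

theorem mem_inputOutputMap_iff (S : LSS D m p n) {τ : TimeAxis} (u : InputSpace τ m)
    (q : SwitchingSpace τ D) (y : τ.Time → Fin p → ℝ) :
    y ∈ S.inputOutputMap τ u q ↔
      ∃ x, S.IsStateTrajectory τ u.1 q.1 x ∧ ∀ t, y t = S.C (q.1 t) *ᵥ x t :=
  exists_congr fun _ => S.isSolution_zero_iff τ q.2

/-- Equivalent systems produce equal outputs along trajectories. -/
theorem Equivalent.output_eq {S : LSS D m p n} {S' : LSS D m p k} {τ : TimeAxis}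
    (h : S'.Equivalent τ S) {u : τ.Time → Fin m → ℝ} {q : τ.Time → Fin D}
    {x : τ.Time → Fin n → ℝ} {z : τ.Time → Fin k → ℝ} (hu : IsInput τ u)
    (hq : IsSwitchingSignal τ q) (hx : S.IsStateTrajectory τ u q x)
    (hz : S'.IsStateTrajectory τ u q z) (t : τ.Time) :
    S.C (q t) *ᵥ x t = S'.C (q t) *ᵥ z t := by
  have h1 : (fun t => S.C (q t) *ᵥ x t) ∈ S.inputOutputMap τ ⟨u, hu⟩ ⟨q, hq⟩ :=
    (S.mem_inputOutputMap_iff _ _ _).2 ⟨x, hx, fun _ => rfl⟩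
  rw [← h, mem_inputOutputMap_iff] at h1
  obtain ⟨z', hz', hy⟩ := h1
  rw [hz'.unique hu hq hz] at hy
  exact hy t

/-- A linear map that intertwines two systems along all trajectories of the first one makes them
equivalent. -/
theorem equivalent_of_linearMap (S : LSS D m p n) (S' : LSS D m p k) (τ : TimeAxis)
    (E : (Fin n → ℝ) →ₗ[ℝ] (Fin k → ℝ)) (U : Set (Fin n → ℝ))
    (hU : ∀ u q x, IsInput τ u → IsSwitchingSignal τ q → S.IsStateTrajectory τ u q x →
      ∀ t, x t ∈ U)
    (hE : ∀ x ∈ U, ∀ i v, E (S.A i *ᵥ x + S.B i *ᵥ v) = S'.A i *ᵥ E x + S'.B i *ᵥ v)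
    (hC : ∀ x ∈ U, ∀ i, S'.C i *ᵥ E x = S.C i *ᵥ x) : S'.Equivalent τ S := by
  funext u q
  ext y
  rw [mem_inputOutputMap_iff, mem_inputOutputMap_iff]
  obtain ⟨x, hx⟩ := S.exists_isStateTrajectory τ u.2 q.2
  have hxU := hU _ _ _ u.2 q.2 hx
  have hx' := hx.map (S' := S') E fun t i v => hE _ (hxU t) i v
  constructor
  · rintro ⟨z, hz, hy⟩
    refine ⟨x, hx, fun t => ?_⟩
    rw [hy, hz.unique u.2 q.2 hx', hC _ (hxU t)]
  · rintro ⟨z, hz, hy⟩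
    refine ⟨_, hx', fun t => ?_⟩
    rw [hy, hz.unique u.2 q.2 hx, hC _ (hxU t)]

/-- The joint reachable space of two systems driven by the same signals. -/
def jointReachable (S : LSS D m p n) (S' : LSS D m p k) (τ : TimeAxis) :
    Submodule ℝ ((Fin n → ℝ) × (Fin k → ℝ)) :=
  Submodule.span ℝ {w | ∃ u q x z, IsInput τ u ∧ IsSwitchingSignal τ q ∧
    S.IsStateTrajectory τ u q x ∧ S'.IsStateTrajectory τ u q z ∧ ∃ t, w = (x t, z t)}

section JointReachable

variable {S : LSS D m p n} {S' : LSS D m p k} {τ : TimeAxis}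

theorem mem_jointReachable {u : τ.Time → Fin m → ℝ} {q : τ.Time → Fin D}
    {x : τ.Time → Fin n → ℝ} {z : τ.Time → Fin k → ℝ} (hu : IsInput τ u)
    (hq : IsSwitchingSignal τ q) (hx : S.IsStateTrajectory τ u q x)
    (hz : S'.IsStateTrajectory τ u q z) (t : τ.Time) : (x t, z t) ∈ S.jointReachable S' τ :=
  Submodule.subset_span ⟨u, q, x, z, hu, hq, hx, hz, t, rfl⟩

/-- Pairs of trajectories start at the origin. -/
theorem exists_zero_mem_trajectories (hD : 0 < D) (S : LSS D m p n) (S' : LSS D m p k)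
    (τ : TimeAxis) : ∃ u q x z, IsInput τ u ∧ IsSwitchingSignal τ q ∧
      S.IsStateTrajectory τ u q x ∧ S'.IsStateTrajectory τ u q z ∧ ∃ t, x t = 0 ∧ z t = 0 := by
  have hu : IsInput τ (0 : τ.Time → Fin m → ℝ) := by
    cases τ
    · exact MemLp.zero' (ε := EuclideanSpace ℝ (Fin m))
    · exact zero_memℓp (E := fun _ => EuclideanSpace ℝ (Fin m))
  have hq : IsSwitchingSignal τ fun _ : τ.Time => (⟨0, hD⟩ : Fin D) := by
    cases τ
    · exact ⟨fun a b => by simp [continuousAt_const], fun t ht => absurd continuousAt_const ht⟩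
    · trivial
  obtain ⟨x, hx⟩ := S.exists_isStateTrajectory τ hu hq
  obtain ⟨z, hz⟩ := S'.exists_isStateTrajectory τ hu hq
  refine ⟨_, _, x, z, hu, hq, hx, hz, ?_⟩
  cases τ
  · exact ⟨_, hx.2.1, hz.2.1⟩
  · exact ⟨_, hx.1, hz.1⟩

/-- Prolong from a time at which both states vanish. -/
theorem input_mem_jointReachable (hD : 0 < D) (i : Fin D) (v : Fin m → ℝ) :
    (S.B i *ᵥ v, S'.B i *ᵥ v) ∈ S.jointReachable S' τ := by
  obtain ⟨u, q, x, z, hu, hq, hx, hz, t, hxt, hzt⟩ := exists_zero_mem_trajectories hD S S' τ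
  obtain ⟨u', q', x', z', hu', hq', hx', hz', -, -, -, hW⟩ := hx.exists_prolongation hu hq hz t i v
  have := hW _ (mem_jointReachable hu' hq' hx' hz')
  simpa [hxt, hzt] using this

/-- The step is affine in `w`, so span induction is run on its linear part, with zero input, and the
input term is added afterwards. -/
theorem step_mem_jointReachable (hD : 0 < D) {w : (Fin n → ℝ) × (Fin k → ℝ)}
    (hw : w ∈ S.jointReachable S' τ) (i : Fin D) (v : Fin m → ℝ) :
    (S.A i *ᵥ w.1 + S.B i *ᵥ v, S'.A i *ᵥ w.2 + S'.B i *ᵥ v) ∈ S.jointReachable S' τ := by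
  have hA : (S.A i *ᵥ w.1, S'.A i *ᵥ w.2) ∈ S.jointReachable S' τ := by
    refine Submodule.span_induction (p := fun w _ =>
      (S.A i *ᵥ w.1, S'.A i *ᵥ w.2) ∈ S.jointReachable S' τ) ?_ ?_ ?_ ?_ hw
    · rintro _ ⟨u, q, x, z, hu, hq, hx, hz, t, rfl⟩
      obtain ⟨u', q', x', z', hu', hq', hx', hz', -, -, -, hW⟩ :=
        hx.exists_prolongation hu hq hz t i 0
      simpa using hW _ (mem_jointReachable hu' hq' hx' hz')
    · simp only [Prod.fst_zero, Prod.snd_zero, Matrix.mulVec_zero]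
      exact zero_mem _
    · intro a b _ _ ha hb
      simpa [Matrix.mulVec_add] using add_mem ha hb
    · intro c a _ ha
      simpa [Matrix.mulVec_smul] using Submodule.smul_mem _ c ha
  exact add_mem hA (input_mem_jointReachable hD i v)

/-- Equivalence compares outputs only in the active mode; prolongation makes any mode active at a
reached pair of states. -/
theorem Equivalent.output_eq_of_mem_jointReachable (h : S'.Equivalent τ S)
    {w : (Fin n → ℝ) × (Fin k → ℝ)} (hw : w ∈ S.jointReachable S' τ) (i : Fin D) :
    S.C i *ᵥ w.1 = S'.C i *ᵥ w.2 := by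
  refine Submodule.span_induction (p := fun w _ => S.C i *ᵥ w.1 = S'.C i *ᵥ w.2) ?_ ?_ ?_ ?_ hw
  · rintro _ ⟨u, q, x, z, hu, hq, hx, hz, t, rfl⟩
    obtain ⟨u', q', x', z', hu', hq', hx', hz', hxt, hzt, hqt, -⟩ :=
      hx.exists_prolongation hu hq hz t i 0
    have := h.output_eq hu' hq' hx' hz' t
    rwa [hxt, hzt, hqt] at this
  · simp
  · intro a b _ _ ha hb
    simp [Matrix.mulVec_add, ha, hb]
  · intro c a _ ha
    simp [Matrix.mulVec_smul, ha]

/-- For a minimal system `S'` equivalent to `S`, the joint reachable space projects onto the state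
space of `S'` (reachability) and meets it trivially (observability). -/
theorem IsMinimal.jointReachable_surjective_injective (hD : 0 < D) (hmin : S'.IsMinimal τ)
    (h : S'.Equivalent τ S) :
    (∀ z, ∃ x, (x, z) ∈ S.jointReachable S' τ) ∧
      ∀ z, ((0 : Fin n → ℝ), z) ∈ S.jointReachable S' τ → z = 0 := by
  set W := S.jointReachable S' τ with hW
  -- `U` is the reachable space of `S'`; `N` consists of states that behave like the zero state of
  -- `S`, hence are unobservable.
  let U : Submodule ℝ (Fin k → ℝ) := W.map (LinearMap.snd ℝ _ _)
  let N : Submodule ℝ (Fin k → ℝ) := W.comap (LinearMap.inr ℝ _ _)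
  have hmemN : ∀ z, z ∈ N ↔ ((0 : Fin n → ℝ), z) ∈ W := fun z => Iff.rfl
  have hmemU : ∀ z, z ∈ U ↔ ∃ x, (x, z) ∈ W := fun z => by
    constructor
    · rintro ⟨⟨x, z⟩, hw, rfl⟩
      exact ⟨x, hw⟩
    · rintro ⟨x, hw⟩
      exact ⟨(x, z), hw, rfl⟩
  have hNA : ∀ z ∈ N, ∀ i, S'.A i *ᵥ z ∈ N := fun z hz i => by
    have := step_mem_jointReachable hD ((hmemN z).1 hz) i 0
    simpa [hmemN] using this
  have hNC : ∀ z ∈ N, ∀ i, S'.C i *ᵥ z = 0 := fun z hz i => by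
    simpa using (h.output_eq_of_mem_jointReachable ((hmemN z).1 hz) i).symm
  obtain ⟨d, E, F, hEF, hFU, hEN, hFE⟩ :=
    exists_subquotient (N := N) (U := U) fun z hz => (hmemU z).2 ⟨0, hz⟩
  let R : LSS D m p d :=
    { A := fun i => LinearMap.toMatrix' (E ∘ₗ Matrix.toLin' (S'.A i) ∘ₗ F)
      B := fun i => LinearMap.toMatrix' (E ∘ₗ Matrix.toLin' (S'.B i))
      C := fun i => LinearMap.toMatrix' (Matrix.toLin' (S'.C i) ∘ₗ F) }
  have hRA : ∀ i y, R.A i *ᵥ y = E (S'.A i *ᵥ F y) := fun i y => LinearMap.toMatrix'_mulVec _ y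
  have hRB : ∀ i v, R.B i *ᵥ v = E (S'.B i *ᵥ v) := fun i v => LinearMap.toMatrix'_mulVec _ v
  have hRC : ∀ i y, R.C i *ᵥ y = S'.C i *ᵥ F y := fun i y => LinearMap.toMatrix'_mulVec _ y
  have hR : R.Equivalent τ S' := by
    refine equivalent_of_linearMap S' R τ E U ?_ ?_ ?_
    · intro u q z hu hq hz t
      obtain ⟨x, hx⟩ := S.exists_isStateTrajectory τ hu hq
      exact (hmemU _).2 ⟨x t, mem_jointReachable hu hq hx hz t⟩
    · intro z hz i v
      -- `z - F (E z)` lies in `N`, which `S'.A i` preserves and `E` kills.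
      have h1 := hEN _ (hNA _ (hFE z hz) i)
      rw [Matrix.mulVec_sub, map_sub, sub_eq_zero] at h1
      rw [map_add, hRA, hRB, h1]
    · intro z hz i
      have h1 := hNC _ (hFE z hz) i
      rw [Matrix.mulVec_sub, sub_eq_zero] at h1
      rw [hRC, h1]
  -- Minimality forces `d = k`, so the injective `F` is bijective; hence `U` is everything and `N`
  -- is zero.
  have hkd : k ≤ d := hmin.2 d R hR
  have hFinj : Function.Injective F := fun a b hab => by rw [← hEF a, hab, hEF]
  have hdk : d = k := by
    refine le_antisymm ?_ hkd
    simpa using LinearMap.finrank_le_finrank_of_injective hFinj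
  subst hdk
  have hFsurj : Function.Surjective F := LinearMap.injective_iff_surjective.1 hFinj
  refine ⟨fun z => ?_, fun z hz => ?_⟩
  · obtain ⟨y, rfl⟩ := hFsurj z
    exact (hmemU _).1 (hFU y)
  · obtain ⟨y, rfl⟩ := hFsurj z
    have h1 := hEN _ ((hmemN _).2 hz)
    rw [hEF] at h1
    rw [h1, map_zero]

end JointReachable

/-- Every `γ` admissible for `S` is admissible for `S'`, so the infimum for `S'` runs over a larger
set. -/
theorem IsMinimal.gainEstimate_le (hD : 0 < D) {S : LSS D m p n} {S' : LSS D m p k}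
    {τ : TimeAxis} (hmin : S'.IsMinimal τ) (h : S'.Equivalent τ S) :
    S'.gainEstimate τ ≤ S.gainEstimate τ := by
  obtain ⟨hsurj, hinj⟩ := hmin.jointReachable_surjective_injective hD h
  refine sInf_le_sInf (Set.image_mono fun γ hγ => ⟨hγ.1, ?_⟩)
  exact gainSet_nonempty_of_relation τ S S' (S.jointReachable S' τ)
    (fun w hw => step_mem_jointReachable hD hw)
    (fun w hw => h.output_eq_of_mem_jointReachable hw) hsurj hinj hγ.2

end LSS

theorem mainTheorem4 (τ : TimeAxis) (D m p : ℕ) (hD : 0 < D) :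
    (∀ (n k : ℕ) (S : LSS D m p n) (Sm : LSS D m p k),
      Sm.IsMinimal τ → Sm.Equivalent τ S → Sm.gainEstimate τ ≤ S.gainEstimate τ) ∧
    (∀ (n₁ n₂ : ℕ) (S₁ : LSS D m p n₁) (S₂ : LSS D m p n₂),
      S₁.IsMinimal τ → S₂.IsMinimal τ → S₁.Equivalent τ S₂ →
        S₁.gainEstimate τ = S₂.gainEstimate τ) ∧
    (∃ Γ : IOMap τ D m p → EReal, ∀ (n : ℕ) (S : LSS D m p n),
      S.IsMinimal τ → S.gainEstimate τ = Γ (S.inputOutputMap τ)) := by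
  have heq : ∀ (n₁ n₂ : ℕ) (S₁ : LSS D m p n₁) (S₂ : LSS D m p n₂),
      S₁.IsMinimal τ → S₂.IsMinimal τ → S₁.Equivalent τ S₂ →
        S₁.gainEstimate τ = S₂.gainEstimate τ := fun n₁ n₂ S₁ S₂ h₁ h₂ h =>
    le_antisymm (h₁.gainEstimate_le hD h) (h₂.gainEstimate_le hD h.symm)
  refine ⟨fun n k S Sm hmin h => hmin.gainEstimate_le hD h, heq, ?_⟩
  classical
  -- The chosen minimal realization does not matter, by `heq`; the value `0` on maps without one is
  -- arbitrary.
  refine ⟨fun f => if h : ∃ (n : ℕ) (S : LSS D m p n), S.IsMinimal τ ∧ S.inputOutputMap τ = f then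
    h.choose_spec.choose.gainEstimate τ else 0, fun n S hS => ?_⟩
  have h : ∃ (k : ℕ) (S' : LSS D m p k), S'.IsMinimal τ ∧
      S'.inputOutputMap τ = S.inputOutputMap τ := ⟨n, S, hS, rfl⟩
  beta_reduce
  rw [dif_pos h]
  have hspec := h.choose_spec.choose_spec
  exact heq _ _ _ _ hS hspec.1 hspec.2.symm
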